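/- All graphs are finite and simple. A dissociation set of a graph $G$ is a set of vertices inducing a subgraph of maximum degree at most $1$; $m(G)$ denotes the number of dissociation sets of $G$ of maximum cardinality. A potted graph is a connected graph containing exactly one cycle such that exactly one vertex of this cycle has degree larger than $2$ in $G$. Let $\mathcal P(n,k)$ be the set of potted graphs of order $n$ whose cycle has order $k$. $P_n$ and $C_n$ are the path and the cycle of order $n$. For vertex-disjoint trees $T_1,\dots,T_r$, let $G_w(T_1,\dots,T_r)$ be a tree obtained from $T_1\cup\dots\cup T_r$ by choosing a leaf in each $T_i$ and identifying these $r$ leaves to a single vertex $w$. Let $C_k+_e G_w(T_1,\dots,T_r)$ be the graph obtained from the disjoint union of $C_k$ and $G_w(T_1,\dots,T_r)$ by adding an edge between $w$ and a vertex of $C_k$, and let $C_k\odot G_w(T_1,\dots,T_r)$ be the graph obtained from the same union by identifying $w$ with a vertex of $C_k$. Up to isomorphism, and with $l\ge 0$ and each $T_i\in\{P_4,K_{1,3}\}$ arbitrary, put - $\mathcal T_1=\{G_w(P_3,P_4,\dots,P_4)\}$ with any number ($\ge 0$) of copies of $P_4$ (with no copy this is $P_3$ with $w$ an end vertex); - $\mathcal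 T_2=\{G_w(P_2,P_3,T_1,\dots,T_l)\}$; - $\mathcal T_3=\{G_w(P_3,P_3,T_1,\dots,T_l)\}$; - $\mathcal T_4=\{G_w(P_2,P_2,P_3,T_1,\dots,T_l)\}$; - $\mathcal T_5=\{G_w(P_2,P_2,P_2,P_2,T_1,\dots,T_l)\}$; - $\mathcal G_j=\{C_k+_e T: T\in\mathcal T_j\}$ for $1\le j\le 5$; - $\mathcal G_6=\{C_k\odot G_w(P_3,T_1,\dots,T_l)\}$; - $\mathcal G_7=\{C_k\odot G_w(P_2,P_2,T_1,\dots,T_l)\}$. Theorem. Let $n,k$ be positive integers with $n\ge k+4$ and $k\equiv 0\pmod 3$, and let $G\in\mathcal P(n,k)$. Then $$m(G)\le\begin{cases}3^{(n-k)/3}+\frac13(n-k)+1,& n\equiv 0\pmod 3,\\ 3^{(n-k-1)/3}+1,& n\equiv 1\pmod 3,\\ 3^{(n-k-2)/3},& n\equiv 2\pmod 3,\end{cases}$$ with equality if and only if $G\in\mathcal G_1$, $G\in\mathcal G_2$, or $G\in\bigcup_{i=3}^{7}\mathcal G_i$, in the three cases respectively. -/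

import Mathlib

noncomputable section

open SimpleGraph

universe u

/-! ### Dissociation sets -/

section Dissociation

variable {V : Type u}

/-- A set of vertices is a dissociation set if it induces a subgraph in which every vertex has
degree at most one. -/
def IsDissociationSet (G : SimpleGraph V) (S : Finset V) : Prop :=
  ∀ v : (S : Set V), ((G.induce (S : Set V)).neighborSet v).ncard ≤ 1

/-- A maximum dissociation set is a dissociation set of the largest cardinality. -/
def IsMaxDissociationSet (G : SimpleGraph V) (S : Finset V) : Prop :=
  IsDissociationSet G S ∧ ∀ T : Finset V, IsDissociationSet G T → T.card ≤ S.card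

/-- `m(G)`, the number of maximum dissociation sets of a finite graph. -/
def numMaxDissociationSets (G : SimpleGraph V) : ℕ :=
  {S : Finset V | IsMaxDissociationSet G S}.ncard

end Dissociation

/-! ### Potted graphs -/

section Potted

variable {V : Type u}

/-- A subgraph is a cycle of `G` if it is traced out by a closed walk that is a cycle. -/
def IsCycleSubgraph (G : SimpleGraph V) (C : G.Subgraph) : Prop :=
  ∃ (v : V) (c : G.Walk v v), c.IsCycle ∧ c.toSubgraph = C

/-- `G ∈ 𝒫(n, k)`: `G` has order `n`, it is connected and contains exactly one cycle `C`
(so it is unicyclic), `C` has order `k`, and exactly one vertex of `C` has degree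
larger than `2` in `G`. -/
def IsPotted [Fintype V] (G : SimpleGraph V) (n k : ℕ) : Prop :=
  Fintype.card V = n ∧ G.Connected ∧
    ∃ C : G.Subgraph, IsCycleSubgraph G C ∧ (∀ C' : G.Subgraph, IsCycleSubgraph G C' → C' = C) ∧
      C.verts.ncard = k ∧ ∃! w : V, w ∈ C.verts ∧ 2 < (G.neighborSet w).ncard

end Potted

/-! ### Graphs with a distinguished vertex, and gluing them together -/

/-- A graph with a distinguished vertex. -/
structure PointedGraph where
  /-- the vertices -/
  Vert : Type
  /-- the graph -/
  graph : SimpleGraph Vert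
  /-- the distinguished vertex -/
  root : Vert

/-- The vertices of the disjoint union of the graphs in `L` after all distinguished vertices
have been identified: `none` is the identified vertex, and the other vertices are
the non-distinguished vertices of the graphs in `L`. -/
abbrev GlueVert (L : List PointedGraph) : Type :=
  Option (Σ i : Fin L.length, {x : (L.get i).Vert // x ≠ (L.get i).root})

open Classical in
/-- The map from the `i`-th graph of `L` to the glued graph. -/
def glueIncl (L : List PointedGraph) (i : Fin L.length) (x : (L.get i).Vert) : GlueVert L :=
  if h : x = (L.get i).root then none else some ⟨i, x, h⟩

/-- The graph obtained from the disjoint union of the graphs in `L` by identifying all their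
distinguished vertices; the identified vertex is the distinguished vertex of the result.
If the distinguished vertices are leaves `vᵢ` of trees `Tᵢ`, this is `G_w(T₁, …, T_r)`
with `w` the distinguished vertex. -/
def glue (L : List PointedGraph) : PointedGraph where
  Vert := GlueVert L
  graph := ⨆ i : Fin L.length, (L.get i).graph.map (glueIncl L i)
  root := none

/-- The path `P_n` of order `n`, the distinguished vertex being an end vertex. -/
def leafPath (n : ℕ) [NeZero n] : PointedGraph := ⟨Fin n, pathGraph n, 0⟩

/-- The star `K_{1,3}`, the distinguished vertex being a leaf. -/
def leafClaw : PointedGraph :=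
  ⟨Fin 1 ⊕ Fin 3, completeBipartiteGraph (Fin 1) (Fin 3), Sum.inr 0⟩

/-- Every graph in the list is `P_4` or `K_{1,3}` (with a leaf as its distinguished vertex). -/
def AllP4OrClaw (L : List PointedGraph) : Prop :=
  ∀ T ∈ L, T = leafPath 4 ∨ T = leafClaw

/-! ### The families `𝒯_1, …, 𝒯_5` of trees with branch vertex `w` -/

/-- `P_3` (with `w` an end vertex, the case `l = 0`) and `G_w(P_3, P_4, …, P_4)`. -/
def treeFamily1 : Set PointedGraph :=
  {T | ∃ l : ℕ, T = glue (leafPath 3 :: List.replicate l (leafPath 4))}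

/-- `G_w(P_2, P_3, T_1, …, T_l)` with `l ≥ 0` and each `T_i` equal to `P_4` or `K_{1,3}`. -/
def treeFamily2 : Set PointedGraph :=
  {T | ∃ L : List PointedGraph, AllP4OrClaw L ∧ T = glue (leafPath 2 :: leafPath 3 :: L)}

/-- `G_w(P_3, P_3, T_1, …, T_l)` with `l ≥ 0` and each `T_i` equal to `P_4` or `K_{1,3}`. -/
def treeFamily3 : Set PointedGraph :=
  {T | ∃ L : List PointedGraph, AllP4OrClaw L ∧ T = glue (leafPath 3 :: leafPath 3 :: L)}

/-- `G_w(P_2, P_2, P_3, T_1, …, T_l)` with `l ≥ 0` and each `T_i` equal to `P_4` or `K_{1,3}`. -/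
def treeFamily4 : Set PointedGraph :=
  {T | ∃ L : List PointedGraph, AllP4OrClaw L ∧
    T = glue (leafPath 2 :: leafPath 2 :: leafPath 3 :: L)}

/-- `G_w(P_2, P_2, P_2, P_2, T_1, …, T_l)` with `l ≥ 0` and each `T_i` equal to `P_4` or
`K_{1,3}`. -/
def treeFamily5 : Set PointedGraph :=
  {T | ∃ L : List PointedGraph, AllP4OrClaw L ∧
    T = glue (leafPath 2 :: leafPath 2 :: leafPath 2 :: leafPath 2 :: L)}

/-! ### The families `𝒢_1, …, 𝒢_7` of potted graphs -/

/-- `C_k +_e T`: the disjoint union of `C_k` and `T` with an edge added between the vertex `c` of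
`C_k` and the distinguished vertex of `T`. -/
def cycleAddEdge (k : ℕ) (c : Fin k) (T : PointedGraph) : SimpleGraph (Fin k ⊕ T.Vert) :=
  (cycleGraph k ⊕g T.graph) ⊔ edge (Sum.inl c) (Sum.inr T.root)

/-- `C_k ⊙ T`: the disjoint union of `C_k` and `T` with the vertex `c` of `C_k` identified with
the distinguished vertex of `T`. -/
def cycleIdentify (k : ℕ) (c : Fin k) (T : PointedGraph) : PointedGraph :=
  glue [⟨Fin k, cycleGraph k, c⟩, T]

/-- The graphs isomorphic to `C_k +_e T` for some `T` in the family `𝒯`. -/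
def edgeFamily (V : Type u) (k : ℕ) (𝒯 : Set PointedGraph) : Set (SimpleGraph V) :=
  {G | ∃ T ∈ 𝒯, ∃ c : Fin k, Nonempty (G ≃g cycleAddEdge k c T)}

/-- `𝒢_1 = {C_k +_e T : T ∈ 𝒯_1}`, up to isomorphism. -/
def potFamily1 (V : Type u) (k : ℕ) : Set (SimpleGraph V) := edgeFamily V k treeFamily1

/-- `𝒢_2 = {C_k +_e T : T ∈ 𝒯_2}`, up to isomorphism. -/
def potFamily2 (V : Type u) (k : ℕ) : Set (SimpleGraph V) := edgeFamily V k treeFamily2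

/-- `𝒢_3 = {C_k +_e T : T ∈ 𝒯_3}`, up to isomorphism. -/
def potFamily3 (V : Type u) (k : ℕ) : Set (SimpleGraph V) := edgeFamily V k treeFamily3

/-- `𝒢_4 = {C_k +_e T : T ∈ 𝒯_4}`, up to isomorphism. -/
def potFamily4 (V : Type u) (k : ℕ) : Set (SimpleGraph V) := edgeFamily V k treeFamily4

/-- `𝒢_5 = {C_k +_e T : T ∈ 𝒯_5}`, up to isomorphism. -/
def potFamily5 (V : Type u) (k : ℕ) : Set (SimpleGraph V) := edgeFamily V k treeFamily5

/-- `𝒢_6 = {C_k ⊙ G_w(P_3, T_1, …, T_l) : T_i = P_4 or K_{1,3}}`, up to isomorphism. -/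
def potFamily6 (V : Type u) (k : ℕ) : Set (SimpleGraph V) :=
  {G | ∃ L : List PointedGraph, AllP4OrClaw L ∧ ∃ c : Fin k,
    Nonempty (G ≃g (cycleIdentify k c (glue (leafPath 3 :: L))).graph)}

/-- `𝒢_7 = {C_k ⊙ G_w(P_2, P_2, T_1, …, T_l) : T_i = P_4 or K_{1,3}}`, up to isomorphism. -/
def potFamily7 (V : Type u) (k : ℕ) : Set (SimpleGraph V) :=
  {G | ∃ L : List PointedGraph, AllP4OrClaw L ∧ ∃ c : Fin k,
    Nonempty (G ≃g (cycleIdentify k c (glue (leafPath 2 :: leafPath 2 :: L))).graph)}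

end
/-
Hang rooted trees on the vertex `w` of the cycle. For a graph with a root, the dissociation sets
fall into three classes according to whether the root is avoided, isolated or matched, and the
largest members of the three classes can be counted recursively when a rooted tree is attached to
the root by an edge. The recursion depends on whether some maximum dissociation set avoids the
root and, if none does, on whether the root is isolated in some of them. As `3 ∣ k`, the cycle has
exactly three maximum dissociation sets, obtained by deleting every third vertex, and just one of
them avoids `w`. Hence the number of maximum dissociation sets is `∏ a(T) + 2 * ∏ b(T)` over the
attached trees `T`, where `a(T)` counts all maximum dissociation sets of `T` and `b(T)` those
avoiding its root.
An induction on trees gives `a(T) ≤ 3 ^ (|T| / 3)`, with a loss of a factor `2 / 3` as soon as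
`|T| ≥ 4`, and `3 * b(T) ≤ 3 ^ (|T| / 3)`. So the extremal configurations are assembled from trees
with at most three vertices, except that a single larger tree may hang on `w`; its branches then
have at most three vertices, and comparing the finitely many shapes gives the three bounds.
-/

noncomputable section

open SimpleGraph

universe u

/-! ### Counting dissociation sets by cardinality -/

section CardEnumerator

open Polynomial

variable {V W : Type*} [Fintype V] [Fintype W]

open Classical in
/-- The generating polynomial, by cardinality, of the sets of vertices with property `p`. -/
def cardEnumerator (p : Finset V → Prop) : ℕ[X] :=
  ∑ S : Finset V, if p S then X ^ S.card else 0

theorem coeff_cardEnumerator (p : Finset V → Prop) (d : ℕ) :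
    (cardEnumerator p).coeff d = {S : Finset V | p S ∧ S.card = d}.ncard := by
  classical
  rw [cardEnumerator, finsetSum_coeff, Set.ncard_eq_toFinset_card', Set.toFinset_ofPred,
    Finset.card_filter]
  refine Finset.sum_congr rfl fun S _ => ?_
  by_cases hp : p S <;> simp [hp, coeff_X_pow, eq_comm]

theorem cardEnumerator_or {p q : Finset V → Prop} (h : ∀ S, p S → ¬ q S) :
    (cardEnumerator fun S => p S ∨ q S) = cardEnumerator p + cardEnumerator q := by
  classical
  simp only [cardEnumerator, ← Finset.sum_add_distrib]
  refine Finset.sum_congr rfl fun S _ => ?_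
  by_cases hp : p S
  · simp [hp, h S hp]
  · simp [hp]

theorem cardEnumerator_mul (p : Finset V → Prop) (q : Finset W → Prop) :
    cardEnumerator p * cardEnumerator q =
      cardEnumerator fun S : Finset (V ⊕ W) => p S.toLeft ∧ q S.toRight := by
  classical
  simp only [cardEnumerator, Finset.sum_mul_sum]
  rw [← Fintype.sum_prod_type']
  refine Fintype.sum_equiv Finset.sumEquiv.toEquiv.symm _ _ fun ⟨A, B⟩ => ?_
  by_cases hp : p A <;> by_cases hq : q B <;>
    simp [Finset.sumEquiv, hp, hq, pow_add]

/-- The degree of `p` is at most `d`, and the coefficient of `X ^ d`, which may vanish, is `k`. -/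
def HasTopCoeff (p : ℕ[X]) (d k : ℕ) : Prop := p.natDegree ≤ d ∧ p.coeff d = k

variable {p q : ℕ[X]} {m n a b : ℕ}

theorem HasTopCoeff.mul (hp : HasTopCoeff p m a) (hq : HasTopCoeff q n b) :
    HasTopCoeff (p * q) (m + n) (a * b) :=
  ⟨natDegree_mul_le_of_le hp.1 hq.1, by
    rw [coeff_mul_add_eq_of_natDegree_le hp.1 hq.1, hp.2, hq.2]⟩

theorem HasTopCoeff.add (hp : HasTopCoeff p m a) (hq : HasTopCoeff q m b) :
    HasTopCoeff (p + q) m (a + b) :=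
  ⟨natDegree_add_le_of_degree_le hp.1 hq.1, by rw [coeff_add, hp.2, hq.2]⟩

theorem HasTopCoeff.of_le (hp : HasTopCoeff p m a) (h : m ≤ n) :
    HasTopCoeff p n (if m = n then a else 0) := by
  split_ifs with hmn
  · exact hmn ▸ hp
  · exact ⟨hp.1.trans h, coeff_eq_zero_of_natDegree_lt (hp.1.trans_lt (lt_of_le_of_ne h hmn))⟩

end CardEnumerator

section DissociationSets

variable {V W : Type*} {G : SimpleGraph V} {H : SimpleGraph W} {r : V} {s : W}

theorem isDissociationSet_iff {S : Finset V} :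
    IsDissociationSet G S ↔ ∀ v ∈ S, ∀ a ∈ S, ∀ b ∈ S, G.Adj v a → G.Adj v b → a = b := by
  rw [IsDissociationSet, Subtype.forall]
  refine forall₂_congr fun v hv => ?_
  rw [Set.ncard_le_one (Set.toFinite _)]
  constructor
  · intro h a ha b hb hva hvb
    exact congrArg Subtype.val (h ⟨a, ha⟩ hva ⟨b, hb⟩ hvb)
  · intro h a ha b hb
    exact Subtype.ext (h a a.2 b b.2 ha hb)

theorem numMaxDissociationSets_congr (e : G ≃g H) :
    numMaxDissociationSets G = numMaxDissociationSets H := by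
  have hdiss : ∀ S, IsDissociationSet H (S.map e.toEquiv.toEmbedding) ↔ IsDissociationSet G S := by
    intro S
    simp only [isDissociationSet_iff, Finset.forall_mem_map]
    simp [e.map_adj_iff]
  have hsurj : (Finset.map e.toEquiv.toEmbedding).Surjective := fun T =>
    ⟨T.map e.toEquiv.symm.toEmbedding, by ext; simp⟩
  have hmax : ∀ S, IsMaxDissociationSet H (S.map e.toEquiv.toEmbedding) ↔
      IsMaxDissociationSet G S := by
    intro S
    simp only [IsMaxDissociationSet, hdiss, hsurj.forall, Finset.card_map]
  rw [numMaxDissociationSets, numMaxDissociationSets]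
  refine Set.ncard_congr (fun S _ => S.map e.toEquiv.toEmbedding) (fun S hS => (hmax S).2 hS)
    (fun S T _ _ h => Finset.map_injective _ h) fun T hT => ?_
  obtain ⟨S, rfl⟩ := hsurj T
  exact ⟨S, (hmax S).1 hT, rfl⟩

theorem HasTopCoeff.numMaxDissociationSets_eq [Fintype V] {d k : ℕ}
    (h : HasTopCoeff (cardEnumerator (IsDissociationSet G)) d k) (hk : 0 < k) :
    numMaxDissociationSets G = k := by
  obtain ⟨hdeg, hcoeff⟩ := h
  have card_le : ∀ S, IsDissociationSet G S → S.card ≤ d := by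
    intro S hS
    refine (Polynomial.le_natDegree_of_ne_zero ?_).trans hdeg
    rw [coeff_cardEnumerator]
    exact Set.ncard_ne_zero_of_mem (a := S) ⟨hS, rfl⟩
  rw [coeff_cardEnumerator] at hcoeff
  obtain ⟨T, hT, hTd⟩ := (Set.ncard_pos (Set.toFinite _)).1 (hk.trans_eq hcoeff.symm)
  rw [numMaxDissociationSets, ← hcoeff]
  congr 1
  ext S
  constructor
  · rintro ⟨hS, hmax⟩
    exact ⟨hS, (card_le S hS).antisymm (hTd ▸ hmax T hT)⟩
  · rintro ⟨hS, hSd⟩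
    exact ⟨hS, fun U hU => hSd ▸ card_le U hU⟩

/-- The vertex `r` has no neighbour in `S`. -/
def IsolatedFrom (G : SimpleGraph V) (r : V) (S : Finset V) : Prop :=
  ∀ a ∈ S, ¬ G.Adj r a

/-- The disjoint union of two graphs, with an edge joining the vertices `r` and `s`. -/
def joinByEdge (G : SimpleGraph V) (H : SimpleGraph W) (r : V) (s : W) : SimpleGraph (V ⊕ W) :=
  (G ⊕g H) ⊔ edge (Sum.inl r) (Sum.inr s)

@[simp] theorem joinByEdge_inl_inl {a b : V} :
    (joinByEdge G H r s).Adj (Sum.inl a) (Sum.inl b) ↔ G.Adj a b := by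
  simp [joinByEdge, edge_adj]

@[simp] theorem joinByEdge_inr_inr {a b : W} :
    (joinByEdge G H r s).Adj (Sum.inr a) (Sum.inr b) ↔ H.Adj a b := by
  simp [joinByEdge, edge_adj]

@[simp] theorem joinByEdge_inl_inr {a : V} {b : W} :
    (joinByEdge G H r s).Adj (Sum.inl a) (Sum.inr b) ↔ a = r ∧ b = s := by
  simp [joinByEdge, edge_adj]

@[simp] theorem joinByEdge_inr_inl {a : V} {b : W} :
    (joinByEdge G H r s).Adj (Sum.inr b) (Sum.inl a) ↔ a = r ∧ b = s := by
  rw [adj_comm, joinByEdge_inl_inr]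

theorem isolatedFrom_joinByEdge {S : Finset (V ⊕ W)} :
    IsolatedFrom (joinByEdge G H r s) (Sum.inl r) S ↔
      IsolatedFrom G r S.toLeft ∧ s ∉ S.toRight := by
  simp only [IsolatedFrom, Sum.forall, joinByEdge_inl_inl, joinByEdge_inl_inr, true_and,
    Finset.mem_toLeft, Finset.mem_toRight]
  grind

theorem isDissociationSet_joinByEdge {S : Finset (V ⊕ W)} :
    IsDissociationSet (joinByEdge G H r s) S ↔
      IsDissociationSet G S.toLeft ∧ IsDissociationSet H S.toRight ∧
        (r ∈ S.toLeft → s ∈ S.toRight →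
          IsolatedFrom G r S.toLeft ∧ IsolatedFrom H s S.toRight) := by
  simp only [isDissociationSet_iff, IsolatedFrom, Sum.forall, Finset.mem_toLeft,
    Finset.mem_toRight, joinByEdge_inl_inl, joinByEdge_inr_inr, joinByEdge_inl_inr,
    joinByEdge_inr_inl, Sum.inl.injEq, Sum.inr.injEq, reduceCtorEq]
  grind

end DissociationSets

section RootPolynomials

open Polynomial

variable {V W : Type*} [Fintype V] [Fintype W]

/-- The generating polynomial of the dissociation sets avoiding `r`. -/
def outPoly (G : SimpleGraph V) (r : V) : ℕ[X] :=
  cardEnumerator fun S => IsDissociationSet G S ∧ r ∉ S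

/-- The generating polynomial of the dissociation sets in which `r` is an isolated vertex. -/
def isolPoly (G : SimpleGraph V) (r : V) : ℕ[X] :=
  cardEnumerator fun S => IsDissociationSet G S ∧ r ∈ S ∧ IsolatedFrom G r S

/-- The generating polynomial of the dissociation sets in which `r` has a neighbour. -/
def pairPoly (G : SimpleGraph V) (r : V) : ℕ[X] :=
  cardEnumerator fun S => IsDissociationSet G S ∧ r ∈ S ∧ ¬ IsolatedFrom G r S

variable (G : SimpleGraph V) (H : SimpleGraph W) (r : V) (s : W)

theorem cardEnumerator_isDissociationSet :
    cardEnumerator (IsDissociationSet G) = outPoly G r + isolPoly G r + pairPoly G r := by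
  rw [outPoly, isolPoly, pairPoly, ← cardEnumerator_or (by tauto), ← cardEnumerator_or (by tauto)]
  congr! 2 with S
  tauto

theorem outPoly_joinByEdge : outPoly (joinByEdge G H r s) (Sum.inl r) =
    outPoly G r * cardEnumerator (IsDissociationSet H) := by
  rw [outPoly, outPoly, cardEnumerator_mul]
  congr! 2 with S
  rw [isDissociationSet_joinByEdge, ← Finset.mem_toLeft]
  tauto

theorem isolPoly_joinByEdge :
    isolPoly (joinByEdge G H r s) (Sum.inl r) = isolPoly G r * outPoly H s := by
  rw [isolPoly, isolPoly, outPoly, cardEnumerator_mul]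
  congr! 2 with S
  rw [isDissociationSet_joinByEdge, isolatedFrom_joinByEdge, ← Finset.mem_toLeft]
  tauto

theorem pairPoly_joinByEdge : pairPoly (joinByEdge G H r s) (Sum.inl r) =
    pairPoly G r * outPoly H s + isolPoly G r * isolPoly H s := by
  rw [pairPoly, pairPoly, isolPoly, outPoly, isolPoly, cardEnumerator_mul, cardEnumerator_mul,
    ← cardEnumerator_or (by tauto)]
  congr! 2 with S
  rw [isDissociationSet_joinByEdge, isolatedFrom_joinByEdge, ← Finset.mem_toLeft]
  tauto

end RootPolynomials

/-! ### The largest dissociation sets of a rooted graph -/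

/-- The status of the root of a graph: `isolated` if it belongs to every maximum dissociation set
and is isolated in some of them, `matched` if it belongs to every maximum dissociation set and
always has a neighbour there, and `free` if it is avoided by some maximum dissociation set. -/
inductive RootKind
  | isolated | matched | free

namespace RootKind

/-- The excess, over the sets avoiding the root, of the sets in which the root is isolated. -/
def isolExcess : RootKind → ℕ
  | isolated => 1 | matched => 0 | free => 0

/-- The excess, over the sets avoiding the root, of the sets in which the root has a neighbour. -/
def pairExcess : RootKind → ℕ
  | isolated => 1 | matched => 1 | free => 0

theorem isolExcess_le_pairExcess : ∀ κ : RootKind, κ.isolExcess ≤ κ.pairExcess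
  | isolated => le_rfl | matched => Nat.zero_le _ | free => le_rfl

end RootKind

/-- The kind of the root of a graph, with the numbers of dissociation sets avoiding the root,
containing it as an isolated vertex, and containing it together with a neighbour. Only sets of the
largest possible cardinality are counted, and that cardinality is prescribed by the kind: it is
`e`, `e + kind.isolExcess` and `e + kind.pairExcess` in the three cases, for some `e`. -/
structure RootCount where
  /-- the status of the root -/
  kind : RootKind
  /-- the number of sets avoiding the root -/
  out : ℕ
  /-- the number of sets in which the root is isolated -/
  isol : ℕ
  /-- the number of sets in which the root is matched -/
  pair : ℕ

namespace RootCount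

/-- The number of maximum dissociation sets. -/
def total : RootCount → ℕ
  | ⟨.isolated, _, b, c⟩ => b + c
  | ⟨.matched, _, _, c⟩ => c
  | ⟨.free, a, b, c⟩ => a + b + c

/-- The number of maximum dissociation sets avoiding the root. -/
def maxOut : RootCount → ℕ
  | ⟨.isolated, _, _, _⟩ => 0
  | ⟨.matched, _, _, _⟩ => 0
  | ⟨.free, a, _, _⟩ => a

/-- The counts after joining the root by an edge to the root of another graph. -/
def join (D E : RootCount) : RootCount :=
  match D.kind, E.kind with
  | .isolated, .free =>
    ⟨.isolated, D.out * E.total, D.isol * E.out, D.pair * E.out + D.isol * E.isol⟩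
  | .isolated, .isolated => ⟨.matched, D.out * E.total, D.isol * E.out, D.isol * E.isol⟩
  | .isolated, .matched =>
    ⟨.free, D.out * E.total, D.isol * E.out, D.pair * E.out + D.isol * E.isol⟩
  | .matched, .free => ⟨.matched, D.out * E.total, D.isol * E.out, D.pair * E.out⟩
  | .matched, .isolated => ⟨.free, D.out * E.total, 0, D.pair * E.out + D.isol * E.isol⟩
  | .matched, .matched => ⟨.free, D.out * E.total, 0, D.pair * E.out⟩
  | .free, .free => ⟨.free, D.out * E.total, D.isol * E.out, D.pair * E.out + D.isol * E.isol⟩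
  | .free, .isolated => ⟨.free, D.out * E.total, 0, D.isol * E.isol⟩
  | .free, .matched => ⟨.free, D.out * E.total, 0, 0⟩

end RootCount

/-- `D` records the largest dissociation sets of the graph `G` with root `r`. -/
def HasRootCount {V : Type*} [Fintype V] (G : SimpleGraph V) (r : V) (D : RootCount) : Prop :=
  ∃ e : ℕ, HasTopCoeff (outPoly G r) e D.out ∧
    HasTopCoeff (isolPoly G r) (e + D.kind.isolExcess) D.isol ∧
    HasTopCoeff (pairPoly G r) (e + D.kind.pairExcess) D.pair

section HasRootCount

variable {V W : Type*} [Fintype V] [Fintype W] {G : SimpleGraph V} {H : SimpleGraph W} {r : V}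
  {s : W} {D E : RootCount} {e : ℕ}

theorem hasTopCoeff_total (hout : HasTopCoeff (outPoly G r) e D.out)
    (hisol : HasTopCoeff (isolPoly G r) (e + D.kind.isolExcess) D.isol)
    (hpair : HasTopCoeff (pairPoly G r) (e + D.kind.pairExcess) D.pair) :
    HasTopCoeff (cardEnumerator (IsDissociationSet G)) (e + D.kind.pairExcess) D.total := by
  rw [cardEnumerator_isDissociationSet G r]
  convert ((hout.of_le (Nat.le_add_right _ _)).add
    (hisol.of_le (Nat.add_le_add_left D.kind.isolExcess_le_pairExcess e))).add hpair using 1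
  rcases D with ⟨_ | _ | _, _, _, _⟩ <;>
    simp [RootCount.total, RootKind.isolExcess, RootKind.pairExcess]

theorem HasRootCount.numMaxDissociationSets_eq (h : HasRootCount G r D) (hD : 0 < D.total) :
    numMaxDissociationSets G = D.total := by
  obtain ⟨e, hout, hisol, hpair⟩ := h
  exact (hasTopCoeff_total hout hisol hpair).numMaxDissociationSets_eq hD

open RootKind in
theorem HasRootCount.joinByEdge (hD : HasRootCount G r D) (hE : HasRootCount H s E) :
    HasRootCount (joinByEdge G H r s) (Sum.inl r) (D.join E) := by
  obtain ⟨d, hout, hisol, hpair⟩ := hD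
  obtain ⟨e, hout', hisol', hpair'⟩ := hE
  refine ⟨d + (e + E.kind.pairExcess), ?_, ?_, ?_⟩
  · rw [outPoly_joinByEdge]
    convert hout.mul (hasTopCoeff_total hout' hisol' hpair') using 1
    rcases D with ⟨_ | _ | _, _, _, _⟩ <;> rcases E with ⟨_ | _ | _, _, _, _⟩ <;> rfl
  · rw [isolPoly_joinByEdge]
    convert (hisol.mul hout').of_le
      (n := d + (e + E.kind.pairExcess) + (D.join E).kind.isolExcess) ?_ using 1
    all_goals
      rcases D with ⟨_ | _ | _, _, _, _⟩ <;> rcases E with ⟨_ | _ | _, _, _, _⟩ <;>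
        simp only [RootCount.join, isolExcess, pairExcess] <;> grind
  · rw [pairPoly_joinByEdge]
    convert ((hpair.mul hout').of_le
      (n := d + (e + E.kind.pairExcess) + (D.join E).kind.pairExcess) ?_).add
      ((hisol.mul hisol').of_le ?_) using 1
    all_goals
      rcases D with ⟨_ | _ | _, _, _, _⟩ <;> rcases E with ⟨_ | _ | _, _, _, _⟩ <;>
        simp only [RootCount.join, isolExcess, pairExcess] <;> grind

end HasRootCount

/-! ### Rooted trees -/

/-- Rooted trees, built from the one-vertex tree by joining the roots of two trees by an edge and
keeping the root of the first one. A rooted tree arises in several ways, one for each order of the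
branches at every vertex. -/
inductive GraftTree
  | leaf : GraftTree
  | graft : GraftTree → GraftTree → GraftTree
  deriving DecidableEq

/-- The pointed graph with one vertex. -/
abbrev PointedGraph.point : PointedGraph := ⟨Unit, ⊥, ()⟩

/-- The graph obtained by joining the distinguished vertices by an edge; the distinguished vertex
of the first graph remains distinguished. -/
def PointedGraph.graft (P Q : PointedGraph) : PointedGraph :=
  ⟨P.Vert ⊕ Q.Vert, joinByEdge P.graph Q.graph P.root Q.root, Sum.inl P.root⟩

namespace GraftTree

/-- The pointed graph described by a rooted tree. -/
def toPointed : GraftTree → PointedGraph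
  | leaf => PointedGraph.point
  | graft s t => s.toPointed.graft t.toPointed

/-- The number of vertices. -/
def size : GraftTree → ℕ
  | leaf => 1
  | graft s t => s.size + t.size

/-- The branches at the root. -/
def children : GraftTree → List GraftTree
  | leaf => []
  | graft s t => s.children ++ [t]

/-- The path of order `2`. -/
abbrev path2 : GraftTree := graft leaf leaf

/-- The path of order `3`, rooted at an end vertex. -/
abbrev path3 : GraftTree := graft leaf path2

/-- The path of order `3`, rooted at its inner vertex. -/
abbrev cherry : GraftTree := graft path2 leaf

theorem size_pos : ∀ t : GraftTree, 0 < t.size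
  | leaf => Nat.one_pos
  | graft s _ => Nat.add_pos_left s.size_pos _

theorem size_eq_children (t : GraftTree) : t.size = 1 + (t.children.map size).sum := by
  induction t with
  | leaf => rfl
  | graft s t hs _ => simp [children, size, hs, add_assoc]

theorem eq_leaf_of_size_le_one : ∀ {t : GraftTree}, t.size ≤ 1 → t = leaf
  | leaf, _ => rfl
  | graft s t, h => by
    have := s.size_pos
    have := t.size_pos
    rw [size] at h
    omega

theorem eq_of_size_le_two : ∀ {t : GraftTree}, t.size ≤ 2 → t = leaf ∨ t = path2
  | leaf, _ => .inl rfl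
  | graft s t, h => by
    have := s.size_pos
    have := t.size_pos
    rw [size] at h
    rw [eq_leaf_of_size_le_one (t := s) (by omega), eq_leaf_of_size_le_one (t := t) (by omega)]
    exact .inr rfl

theorem eq_of_size_le_three : ∀ {t : GraftTree}, t.size ≤ 3 →
    t = leaf ∨ t = path2 ∨ t = path3 ∨ t = cherry
  | leaf, _ => .inl rfl
  | graft s t, h => by
    have := s.size_pos
    have := t.size_pos
    rw [size] at h
    obtain rfl | rfl := eq_of_size_le_two (t := s) (by omega) <;>
      obtain rfl | rfl := eq_of_size_le_two (t := t) (by omega) <;> simp_all [size]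

/-- The counts of the largest dissociation sets. -/
def count : GraftTree → RootCount
  | leaf => ⟨.isolated, 1, 1, 0⟩
  | graft s t => s.count.join t.count

end GraftTree

open GraftTree

/-- Attach a list of rooted trees to the distinguished vertex of a graph. -/
def PointedGraph.attach (P : PointedGraph) (ts : List GraftTree) : PointedGraph :=
  ts.foldl (fun Q t => Q.graft t.toPointed) P

theorem PointedGraph.attach_append_singleton (P : PointedGraph) (ts : List GraftTree)
    (t : GraftTree) : P.attach (ts ++ [t]) = (P.attach ts).graft t.toPointed := by
  simp [attach]

theorem GraftTree.toPointed_eq_attach (t : GraftTree) :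
    t.toPointed = PointedGraph.point.attach t.children := by
  induction t with
  | leaf => rfl
  | graft s t hs _ => rw [children, PointedGraph.attach_append_singleton, ← hs, toPointed]

namespace RootCount

/-- The counts after attaching a list of rooted trees. -/
def attach (D : RootCount) (ts : List GraftTree) : RootCount :=
  ts.foldl (fun D t => D.join t.count) D

@[simp] theorem attach_nil (D : RootCount) : D.attach [] = D := rfl

@[simp] theorem attach_cons (D : RootCount) (t : GraftTree) (ts : List GraftTree) :
    D.attach (t :: ts) = (D.join t.count).attach ts := rfl

theorem attach_append (D : RootCount) (ts us : List GraftTree) :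
    D.attach (ts ++ us) = (D.attach ts).attach us := List.foldl_append

theorem join_right_comm (D E F : RootCount) : (D.join E).join F = (D.join F).join E := by
  rcases D with ⟨_ | _ | _, _, _, _⟩ <;> rcases E with ⟨_ | _ | _, _, _, _⟩ <;>
    rcases F with ⟨_ | _ | _, _, _, _⟩ <;>
    simp only [join, total, mk.injEq, true_and] <;> constructorm* _ ∧ _ <;> first | trivial | ring

theorem attach_perm (D : RootCount) {ts us : List GraftTree} (h : ts.Perm us) :
    D.attach ts = D.attach us :=
  haveI : RightCommutative fun (D : RootCount) (t : GraftTree) => D.join t.count :=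
    ⟨fun _ _ _ => join_right_comm _ _ _⟩
  h.foldl_eq D

theorem attach_of_isol_eq_zero (a c : ℕ) (ts : List GraftTree) :
    attach ⟨.free, a, 0, c⟩ ts = ⟨.free, a * (ts.map fun t => t.count.total).prod, 0,
      c * (ts.map fun t => t.count.maxOut).prod⟩ := by
  induction ts generalizing a c with
  | nil => simp
  | cons t ts ih =>
    have hjoin : join ⟨.free, a, 0, c⟩ t.count =
        ⟨.free, a * t.count.total, 0, c * t.count.maxOut⟩ := by
      obtain ⟨_ | _ | _, _, _, _⟩ := t.count <;> simp [join, maxOut]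
    rw [attach_cons, hjoin, ih, List.map_cons, List.prod_cons, List.map_cons, List.prod_cons,
      mul_assoc, mul_assoc]

/-- The counts that are relevant for the number of maximum dissociation sets do not vanish. -/
def Pos (D : RootCount) : Prop :=
  0 < D.out ∧ (D.kind ≠ .free → 0 < D.isol) ∧ (D.kind = .matched → 0 < D.pair)

theorem Pos.total_pos {D : RootCount} (h : D.Pos) : 0 < D.total := by
  rcases D with ⟨_ | _ | _, _, _, _⟩ <;> simp_all [Pos, total]

theorem join_out (D E : RootCount) : (D.join E).out = D.out * E.total := by
  rcases D with ⟨_ | _ | _, _, _, _⟩ <;> rcases E with ⟨_ | _ | _, _, _, _⟩ <;> rfl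

theorem Pos.join {D E : RootCount} (hD : D.Pos) (hE : E.Pos) : (D.join E).Pos := by
  refine ⟨join_out D E ▸ Nat.mul_pos hD.1 hE.total_pos, ?_⟩
  rcases D with ⟨_ | _ | _, _, _, _⟩ <;> rcases E with ⟨_ | _ | _, _, _, _⟩ <;>
    simp_all [Pos, RootCount.join]

end RootCount

theorem GraftTree.count_eq_attach (t : GraftTree) :
    t.count = leaf.count.attach t.children := by
  induction t with
  | leaf => rfl
  | graft s t hs _ => rw [children, RootCount.attach_append, ← hs]; rfl

theorem GraftTree.count_pos (t : GraftTree) : t.count.Pos := by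
  induction t with
  | leaf => simp [RootCount.Pos, count]
  | graft s t hs ht => exact hs.join ht

/-- The pointed graph has `n` vertices, and its largest dissociation sets are counted by `D`. -/
def PointedGraph.Counted (P : PointedGraph) (n : ℕ) (D : RootCount) : Prop :=
  ∃ _ : Fintype P.Vert, Fintype.card P.Vert = n ∧ HasRootCount P.graph P.root D

theorem PointedGraph.Counted.graft {P Q : PointedGraph} {m n : ℕ} {D E : RootCount}
    (hP : P.Counted m D) (hQ : Q.Counted n E) : (P.graft Q).Counted (m + n) (D.join E) := by
  obtain ⟨hfinP, rfl, hD⟩ := hP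
  obtain ⟨hfinQ, rfl, hE⟩ := hQ
  exact ⟨inferInstanceAs (Fintype (P.Vert ⊕ Q.Vert)), Fintype.card_sum, hD.joinByEdge hE⟩

theorem PointedGraph.point_counted : point.Counted 1 ⟨.isolated, 1, 1, 0⟩ := by
  have huniv : (Finset.univ : Finset (Finset Unit)) = {∅, {()}} := by decide
  have hout : outPoly (⊥ : SimpleGraph Unit) () = 1 := by
    simp [outPoly, cardEnumerator, huniv, isDissociationSet_iff]
  have hisol : isolPoly (⊥ : SimpleGraph Unit) () = Polynomial.X := by
    simp [isolPoly, cardEnumerator, huniv, isDissociationSet_iff, IsolatedFrom]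
  have hpair : pairPoly (⊥ : SimpleGraph Unit) () = 0 := by
    simp [pairPoly, cardEnumerator, isDissociationSet_iff, IsolatedFrom]
  refine ⟨inferInstanceAs (Fintype Unit), rfl, 0, ?_⟩
  simp [hout, hisol, hpair, HasTopCoeff, RootKind.isolExcess]

theorem GraftTree.counted (t : GraftTree) : t.toPointed.Counted t.size t.count := by
  induction t with
  | leaf => exact PointedGraph.point_counted
  | graft s t hs ht => exact hs.graft ht

theorem PointedGraph.Counted.attach {P : PointedGraph} {n : ℕ} {D : RootCount}
    (hP : P.Counted n D) (ts : List GraftTree) :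
    (P.attach ts).Counted (n + (ts.map size).sum) (D.attach ts) := by
  induction ts generalizing P n D with
  | nil => simpa [PointedGraph.attach] using hP
  | cons t ts ih =>
    simpa [PointedGraph.attach, add_assoc] using ih (hP.graft t.counted)

/-! ### Bounds for the counts of rooted trees -/

namespace RootKind

/-- A tree of order `n` whose root has this kind has at most `3 ^ ((n - outLoss) / 3)` largest
dissociation sets avoiding the root. -/
def outLoss : RootKind → ℕ
  | isolated => 1 | matched => 2 | free => 3

/-- The number of factors `3` by which the bound for the number of maximum dissociation sets exceeds
the bound for the number of largest ones avoiding the root. -/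
def totalGain : RootKind → ℕ
  | isolated => 0 | matched => 0 | free => 1

end RootKind

namespace RootCount

/-- The bounds satisfied by the counts of a rooted tree of order `n ≥ 4` with `U = 3 ^ e`, where
`e` is the exponent of the tree. The factor `13 / 9` comes from a path of order `3` which is
attached by an end vertex to a tree with a free root for which `a = U`, `3 * b = U` and
`3 * c = 2 * U`. -/
def BoundedBy (n U : ℕ) : RootCount → Prop
  | ⟨.isolated, a, b, c⟩ =>
    a ≤ U ∧ 3 * b ≤ U ∧ 3 * c ≤ U ∧ (5 ≤ n → 9 * (a + 2 * b + c) ≤ 13 * U)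
  | ⟨.matched, a, b, c⟩ =>
    a ≤ U ∧ b ≤ U ∧ 3 * c ≤ U ∧ a + b + c ≤ 2 * U ∧ (6 ≤ n → 9 * (a + b + c) ≤ 13 * U)
  | ⟨.free, a, b, c⟩ =>
    a ≤ U ∧ b ≤ U ∧ 3 * (a + b) ≤ 4 * U ∧ a + b + c ≤ 2 * U ∧ (7 ≤ n → 9 * (a + b + c) ≤ 13 * U)

variable {m n U W : ℕ} {D E : RootCount}

theorem BoundedBy.out_le (h : D.BoundedBy n U) : D.out ≤ U := by
  rcases D with ⟨_ | _ | _, _, _, _⟩ <;> exact h.1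

theorem BoundedBy.total_le (h : D.BoundedBy n U) :
    3 * D.total ≤ 2 * (U * 3 ^ D.kind.totalGain) := by
  rcases D with ⟨_ | _ | _, _, _, _⟩ <;> simp only [BoundedBy, total, RootKind.totalGain] at * <;>
    omega

theorem BoundedBy.join_small (hD : D.BoundedBy m U) {t : GraftTree} (ht : t.size ≤ 3) :
    (D.join t.count).BoundedBy (m + t.size) (U * 3 ^ t.count.kind.totalGain) := by
  obtain rfl | rfl | rfl | rfl := eq_of_size_le_three ht <;> rcases D with ⟨_ | _ | _, _, _, _⟩ <;>
    simp only [BoundedBy, join, total, RootKind.totalGain, count, size] at * <;> omega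

theorem BoundedBy.small_join (hE : E.BoundedBy n W) {s : GraftTree} (hs : s.size ≤ 3) :
    (s.count.join E).BoundedBy (s.size + n) (W * 3 ^ E.kind.totalGain) := by
  obtain rfl | rfl | rfl | rfl := eq_of_size_le_three hs <;> rcases E with ⟨_ | _ | _, _, _, _⟩ <;>
    simp only [BoundedBy, join, total, RootKind.totalGain, count, size] at * <;> omega

theorem BoundedBy.join (hD : D.BoundedBy m U) (hE : E.BoundedBy n W) (k : ℕ) :
    (D.join E).BoundedBy k (U * (W * 3 ^ E.kind.totalGain)) := by
  rcases D with ⟨_ | _ | _, a, b, c⟩ <;> rcases E with ⟨_ | _ | _, a', b', c'⟩ <;>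
    simp only [BoundedBy, RootCount.join, total, RootKind.totalGain] at * <;>
    constructorm* _ ∧ _ <;> intros <;> nlinarith

theorem BoundedBy.three_mul_maxOut_le (h : D.BoundedBy n U) :
    3 * D.maxOut ≤ U * 3 ^ D.kind.totalGain := by
  rcases D with ⟨_ | _ | _, _, _, _⟩ <;> simp only [BoundedBy, maxOut, RootKind.totalGain] at * <;>
    omega

theorem outLoss_join_add_le (D E : RootCount) :
    (D.join E).kind.outLoss + 3 * E.kind.totalGain ≤ D.kind.outLoss + E.kind.outLoss := by
  rcases D with ⟨_ | _ | _, _, _, _⟩ <;> rcases E with ⟨_ | _ | _, _, _, _⟩ <;>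
    simp [join, RootKind.outLoss, RootKind.totalGain]

end RootCount

namespace GraftTree

/-- The exponent `e` for which `3 ^ e` is the natural bound for the number of largest dissociation
sets avoiding the root. -/
def exponent : GraftTree → ℕ
  | leaf => 0
  | graft s t => s.exponent + (t.exponent + t.count.kind.totalGain)

theorem three_mul_exponent_add_outLoss_le (t : GraftTree) :
    3 * t.exponent + t.count.kind.outLoss ≤ t.size := by
  induction t with
  | leaf => exact le_rfl
  | graft s t hs ht =>
    have := RootCount.outLoss_join_add_le s.count t.count
    simp only [exponent, size, count]
    omega

theorem exponent_add_totalGain_le (t : GraftTree) :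
    t.exponent + t.count.kind.totalGain ≤ t.size / 3 := by
  have hexp := t.three_mul_exponent_add_outLoss_le
  have hgain : 3 * t.count.kind.totalGain ≤ t.count.kind.outLoss := by
    cases t.count.kind <;> simp [RootKind.outLoss, RootKind.totalGain]
  omega

theorem exponent_eq_zero_of_size_le_three {t : GraftTree} (ht : t.size ≤ 3) : t.exponent = 0 := by
  obtain rfl | rfl | rfl | rfl := eq_of_size_le_three ht <;> rfl

theorem boundedBy_of_size_le_three {s t : GraftTree} (hs : s.size ≤ 3) (ht : t.size ≤ 3)
    (h : 4 ≤ (graft s t).size) :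
    (graft s t).count.BoundedBy (graft s t).size (3 ^ (graft s t).exponent) := by
  obtain rfl | rfl | rfl | rfl := eq_of_size_le_three hs <;>
    obtain rfl | rfl | rfl | rfl := eq_of_size_le_three ht <;>
    revert h <;> simp [RootCount.BoundedBy, size, exponent, count, RootCount.join, RootCount.total,
      RootKind.totalGain]

theorem boundedBy {t : GraftTree} (h : 4 ≤ t.size) : t.count.BoundedBy t.size (3 ^ t.exponent) := by
  induction t with
  | leaf => simp [size] at h
  | graft s t ihs iht =>
    rcases le_or_gt s.size 3 with hs | hs <;> rcases le_or_gt t.size 3 with ht | ht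
    · exact boundedBy_of_size_le_three hs ht h
    · rw [exponent, exponent_eq_zero_of_size_le_three hs, zero_add, pow_add]
      exact (iht ht).small_join hs
    · rw [exponent, exponent_eq_zero_of_size_le_three ht, zero_add, pow_add]
      exact (ihs hs).join_small ht
    · rw [exponent, pow_add, pow_add]
      exact (ihs hs).join (iht ht) _

theorem out_le (t : GraftTree) : t.count.out ≤ 3 ^ t.exponent := by
  rcases le_or_gt t.size 3 with ht | ht
  · obtain rfl | rfl | rfl | rfl := eq_of_size_le_three ht <;> decide
  · exact (boundedBy ht).out_le

theorem three_mul_total_le {t : GraftTree} (h : 4 ≤ t.size) :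
    3 * t.count.total ≤ 2 * 3 ^ (t.exponent + t.count.kind.totalGain) :=
  pow_add 3 t.exponent _ ▸ (boundedBy h).total_le

theorem total_le (t : GraftTree) :
    t.count.total ≤ 3 ^ (t.exponent + t.count.kind.totalGain) := by
  rcases le_or_gt t.size 3 with ht | ht
  · obtain rfl | rfl | rfl | rfl := eq_of_size_le_three ht <;> decide
  · have := three_mul_total_le ht
    omega

theorem three_mul_maxOut_le (t : GraftTree) : 3 * t.count.maxOut ≤ 3 ^ (t.size / 3) := by
  rcases le_or_gt t.size 3 with ht | ht
  · obtain rfl | rfl | rfl | rfl := eq_of_size_le_three ht <;> decide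
  · refine (boundedBy ht).three_mul_maxOut_le.trans ?_
    rw [← pow_add]
    exact Nat.pow_le_pow_right three_pos t.exponent_add_totalGain_le

theorem three_mul_out_le_of_large_child {t : GraftTree} (h : ¬ ∀ c ∈ t.children, c.size ≤ 3) :
    3 * t.count.out ≤ 2 * 3 ^ t.exponent := by
  induction t with
  | leaf => simp [children] at h
  | graft s t hs _ =>
    rw [count, RootCount.join_out, exponent, pow_add]
    rcases le_or_gt t.size 3 with ht | ht
    · have hsout := hs fun hc => h fun c hmem => by
        rw [children, List.mem_append, List.mem_singleton] at hmem
        exact hmem.elim (hc c) (· ▸ ht)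
      calc 3 * (s.count.out * t.count.total) = 3 * s.count.out * t.count.total := by ring
        _ ≤ 2 * 3 ^ s.exponent * 3 ^ (t.exponent + t.count.kind.totalGain) :=
          Nat.mul_le_mul hsout t.total_le
        _ = _ := by ring
    · calc 3 * (s.count.out * t.count.total) = s.count.out * (3 * t.count.total) := by ring
        _ ≤ 3 ^ s.exponent * (2 * 3 ^ (t.exponent + t.count.kind.totalGain)) :=
          Nat.mul_le_mul s.out_le (three_mul_total_le ht)
        _ = _ := by ring

theorem total_le_three_pow (t : GraftTree) : t.count.total ≤ 3 ^ (t.size / 3) :=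
  t.total_le.trans (Nat.pow_le_pow_right three_pos t.exponent_add_totalGain_le)

end GraftTree

/-! ### Lists of rooted trees -/

theorem three_pow_div_mul_le (m n : ℕ) : 3 ^ (m / 3) * 3 ^ (n / 3) ≤ 3 ^ ((m + n) / 3) := by
  rw [← pow_add]
  exact Nat.pow_le_pow_right three_pos (by omega)

theorem prod_total_le (ts : List GraftTree) :
    (ts.map fun t => t.count.total).prod ≤ 3 ^ ((ts.map size).sum / 3) := by
  induction ts with
  | nil => simp
  | cons t ts ih =>
    simp only [List.map_cons, List.prod_cons, List.sum_cons]
    exact (Nat.mul_le_mul t.total_le_three_pow ih).trans (three_pow_div_mul_le _ _)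

theorem three_pow_mul_prod_maxOut_le (ts : List GraftTree) :
    3 ^ ts.length * (ts.map fun t => t.count.maxOut).prod ≤ 3 ^ ((ts.map size).sum / 3) := by
  induction ts with
  | nil => simp
  | cons t ts ih =>
    simp only [List.map_cons, List.prod_cons, List.sum_cons, List.length_cons]
    calc _ = 3 * t.count.maxOut * (3 ^ ts.length * (ts.map fun t => t.count.maxOut).prod) := by ring
      _ ≤ _ := (Nat.mul_le_mul t.three_mul_maxOut_le ih).trans (three_pow_div_mul_le _ _)

theorem three_mul_prod_total_le {ts : List GraftTree} (h : ¬ ∀ t ∈ ts, t.size ≤ 3) :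
    3 * (ts.map fun t => t.count.total).prod ≤ 2 * 3 ^ ((ts.map size).sum / 3) := by
  push Not at h
  obtain ⟨t, hmem, ht⟩ := h
  have hperm := List.perm_cons_erase hmem
  rw [(hperm.map size).sum_eq, (hperm.map fun t => t.count.total).prod_eq]
  simp only [List.map_cons, List.prod_cons, List.sum_cons]
  calc _ = 3 * t.count.total * ((ts.erase t).map fun t => t.count.total).prod := by ring
    _ ≤ 2 * 3 ^ (t.size / 3) * 3 ^ (((ts.erase t).map size).sum / 3) :=
      Nat.mul_le_mul ((three_mul_total_le ht).trans (Nat.mul_le_mul_left 2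
        (Nat.pow_le_pow_right three_pos t.exponent_add_totalGain_le))) (prod_total_le _)
    _ ≤ _ := by rw [mul_assoc]; exact Nat.mul_le_mul_left 2 (three_pow_div_mul_le _ _)

/-! ### The extremal problem for lists of rooted trees -/

/-- Every tree of the list has order `3`, and attaching it does not change the kind of a root. -/
def AllOrder3 (M : List GraftTree) : Prop := ∀ t ∈ M, t = path3 ∨ t = cherry

/-- The list consists of the trees in `bs` and of further trees of order `3`. -/
def IsOrder3Extension (bs ts : List GraftTree) : Prop := ∃ M, AllOrder3 M ∧ ts.Perm (bs ++ M)

section Order3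

variable {M ts : List GraftTree}

theorem AllOrder3.of_cons {t : GraftTree} (h : AllOrder3 (t :: M)) : AllOrder3 M :=
  (List.forall_mem_cons.1 h).2

theorem AllOrder3.map_eq_replicate {α : Type*} (hM : AllOrder3 M) {f : GraftTree → α} {a : α}
    (hpath : f path3 = a) (hcherry : f cherry = a) : M.map f = List.replicate M.length a := by
  refine List.eq_replicate_iff.2 ⟨List.length_map f, fun b hb => ?_⟩
  obtain ⟨t, ht, rfl⟩ := List.mem_map.1 hb
  obtain rfl | rfl := hM t ht <;> assumption

theorem AllOrder3.kind_attach (hM : AllOrder3 M) (D : RootCount) :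
    (D.attach M).kind = D.kind := by
  induction M generalizing D with
  | nil => rfl
  | cons t M ih =>
    rw [RootCount.attach_cons, ih hM.of_cons]
    obtain rfl | rfl := hM t List.mem_cons_self <;> obtain ⟨_ | _ | _, _, _, _⟩ := D <;> rfl

/-- A path attached by an end vertex gives a new largest dissociation set that pairs the root with
its neighbour, a path attached by its middle vertex does not. -/
theorem AllOrder3.attach_free (hM : AllOrder3 M) (a b c : ℕ) :
    RootCount.attach ⟨.free, a, b, c⟩ M =
      ⟨.free, a * 3 ^ M.length, b, c + b * M.count path3⟩ := by
  induction M generalizing a c with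
  | nil => simp
  | cons t M ih =>
    rw [RootCount.attach_cons]
    obtain rfl | rfl := hM t List.mem_cons_self
    · rw [show (RootCount.mk .free a b c).join path3.count = ⟨.free, a * 3, b, c + b⟩ by
        simp [count, RootCount.join, RootCount.total, add_comm], ih hM.of_cons,
        List.count_cons_self, List.length_cons]
      congr 1 <;> ring
    · rw [show (RootCount.mk .free a b c).join cherry.count = ⟨.free, a * 3, b, c⟩ by
        simp [count, RootCount.join, RootCount.total], ih hM.of_cons,
        List.count_cons_of_ne (by decide), List.length_cons]
      congr 1; ring

theorem exists_perm_of_size_le_three (h : ∀ t ∈ ts, t.size ≤ 3) :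
    ∃ i j M, AllOrder3 M ∧ ts.Perm (List.replicate i leaf ++ (List.replicate j path2 ++ M)) := by
  induction ts with
  | nil => exact ⟨0, 0, [], by simp [AllOrder3], .refl _⟩
  | cons t ts ih =>
    rw [List.forall_mem_cons] at h
    obtain ⟨i, j, M, hM, hp⟩ := ih h.2
    have order3 (ht : t = path3 ∨ t = cherry) : ∃ i j M, AllOrder3 M ∧
        (t :: ts).Perm (List.replicate i leaf ++ (List.replicate j path2 ++ M)) :=
      ⟨i, j, t :: M, List.forall_mem_cons.2 ⟨ht, hM⟩, (hp.cons t).trans <|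
        List.perm_middle.symm.trans (List.perm_middle.symm.append_left _)⟩
    obtain rfl | rfl | ht := eq_of_size_le_three h.1
    · exact ⟨i + 1, j, M, hM, hp.cons leaf⟩
    · exact ⟨i, j + 1, M, hM, (hp.cons path2).trans List.perm_middle.symm⟩
    · exact order3 ht

theorem AllOrder3.sum_size_of_perm {bs : List GraftTree} (hM : AllOrder3 M)
    (h : ts.Perm (bs ++ M)) : (ts.map size).sum = (bs.map size).sum + 3 * M.length := by
  rw [(h.map size).sum_eq, List.map_append, List.sum_append,
    hM.map_eq_replicate (f := size) rfl rfl]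
  simp [mul_comm, show path3.size = 3 from rfl]

theorem sum_size_of_perm {i j : ℕ} (hM : AllOrder3 M)
    (h : ts.Perm (List.replicate i leaf ++ (List.replicate j path2 ++ M))) :
    (ts.map size).sum = i + 2 * j + 3 * M.length := by
  rw [← List.append_assoc] at h
  rw [hM.sum_size_of_perm h]
  simp [size, mul_comm]

end Order3

/-- The number of maximum dissociation sets of a cycle whose order is a multiple of `3`, with the
given rooted trees attached to one of its vertices. -/
def potCount (ts : List GraftTree) : ℕ := (RootCount.attach ⟨.free, 1, 0, 2⟩ ts).total

theorem potCount_eq (ts : List GraftTree) : potCount ts =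
    (ts.map fun t => t.count.total).prod + 2 * (ts.map fun t => t.count.maxOut).prod := by
  simp [potCount, RootCount.attach_of_isol_eq_zero, RootCount.total]

theorem potCount_singleton (t : GraftTree) :
    potCount [t] = t.count.total + 2 * t.count.maxOut := by
  simp [potCount_eq]

theorem potCount_of_perm {ts M : List GraftTree} {i j : ℕ} (hM : AllOrder3 M)
    (h : ts.Perm (List.replicate i leaf ++ (List.replicate j path2 ++ M))) :
    potCount ts = 3 ^ M.length + 2 * 0 ^ (i + j) := by
  rw [potCount_eq, (h.map _).prod_eq, (h.map fun t => t.count.maxOut).prod_eq]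
  simp only [List.map_append, List.prod_append, List.map_replicate, List.prod_replicate]
  rw [hM.map_eq_replicate (f := fun t => t.count.total) (a := 3) rfl rfl,
    hM.map_eq_replicate (f := fun t => t.count.maxOut) (a := 1) rfl rfl,
    show leaf.count.total = 1 from rfl, show path2.count.total = 1 from rfl,
    show leaf.count.maxOut = 0 from rfl, show path2.count.maxOut = 0 from rfl]
  simp [pow_add]

theorem potCount_singleton_of_perm {t : GraftTree} {bs M : List GraftTree} {a b c : ℕ}
    (hM : AllOrder3 M) (h : t.children.Perm (bs ++ M))
    (hbs : leaf.count.attach bs = ⟨.free, a, b, c⟩) :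
    potCount [t] = a * 3 ^ (M.length + 1) + b * (M.count path3 + 1) + c := by
  rw [potCount_singleton, count_eq_attach, RootCount.attach_perm _ h, RootCount.attach_append, hbs,
    hM.attach_free, RootCount.total, RootCount.maxOut]
  ring

/-- The maximum of `potCount` among the lists of total order `N ≥ 4`. -/
def potBound (N : ℕ) : ℕ :=
  3 ^ (N / 3) + if N % 3 = 0 then N / 3 + 1 else if N % 3 = 1 then 1 else 0

theorem potBound_three_mul (m : ℕ) : potBound (3 * m) = 3 ^ m + m + 1 := by
  simp [potBound, add_assoc]

theorem potBound_three_mul_add_one (m : ℕ) : potBound (3 * m + 1) = 3 ^ m + 1 := by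
  simp [potBound, Nat.mul_add_div]

theorem potBound_three_mul_add_two (m : ℕ) : potBound (3 * m + 2) = 3 ^ m := by
  simp [potBound, Nat.mul_add_div]

theorem three_pow_div_le_potBound (N : ℕ) : 3 ^ (N / 3) ≤ potBound N := Nat.le_add_right _ _

theorem three_pow_lt_potBound {m N : ℕ} (h : 3 * m ≤ N) (hne : N ≠ 3 * m + 2) :
    3 ^ m < potBound N := by
  obtain rfl | rfl | hlt : N = 3 * m ∨ N = 3 * m + 1 ∨ m < N / 3 := by omega
  · rw [potBound_three_mul]
    omega
  · rw [potBound_three_mul_add_one]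
    omega
  · exact (Nat.pow_lt_pow_right (by norm_num) hlt).trans_le (three_pow_div_le_potBound N)

/-- The lists attaining the maximum when the order is a multiple of `3`. -/
def Extremal0 (ts : List GraftTree) : Prop :=
  ∃ t m, ts = [t] ∧ t.children.Perm (path2 :: List.replicate m path3)

/-- The lists attaining the maximum when the order is `1` modulo `3`. -/
def Extremal1 (ts : List GraftTree) : Prop :=
  ∃ t, ts = [t] ∧ IsOrder3Extension [leaf, path2] t.children

/-- The lists attaining the maximum when the order is `2` modulo `3`. -/
def Extremal2 (ts : List GraftTree) : Prop :=
  (∃ t, ts = [t] ∧ (IsOrder3Extension [path2, path2] t.children ∨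
    IsOrder3Extension [leaf, leaf, path2] t.children ∨
    IsOrder3Extension [leaf, leaf, leaf, leaf] t.children)) ∨
  IsOrder3Extension [path2] ts ∨ IsOrder3Extension [leaf, leaf] ts

section Extremal

variable {t : GraftTree} {ts bs M : List GraftTree} {c : ℕ}

theorem AllOrder3.size_of_perm (hM : AllOrder3 M) (h : t.children.Perm (bs ++ M)) :
    ([t].map size).sum = (bs.map size).sum + 3 * M.length + 1 := by
  rw [List.map_singleton, List.sum_singleton, size_eq_children, hM.sum_size_of_perm h]
  ring

theorem IsOrder3Extension.exists_potCount_singleton (h : IsOrder3Extension bs t.children)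
    (hbs : leaf.count.attach bs = ⟨.free, 1, 0, c⟩) :
    ∃ m, potCount [t] = 3 ^ (m + 1) + c ∧
      ([t].map size).sum = (bs.map size).sum + 3 * m + 1 := by
  obtain ⟨M, hM, h⟩ := h
  exact ⟨M.length, by simp [potCount_singleton_of_perm hM h hbs], hM.size_of_perm h⟩

theorem Extremal0.potCount_eq (h : Extremal0 ts) :
    potCount ts = potBound (ts.map size).sum ∧ (ts.map size).sum % 3 = 0 := by
  obtain ⟨t, m, rfl, h⟩ := h
  have hM : AllOrder3 (List.replicate m path3) := fun s hs => .inl (List.eq_of_mem_replicate hs)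
  have hsize : ([t].map size).sum = 3 * (m + 1) := by
    rw [hM.size_of_perm (bs := [path2]) h, List.length_replicate,
      show ([path2].map size).sum = 2 from rfl]
    ring
  rw [hsize, potBound_three_mul,
    potCount_singleton_of_perm (bs := [path2]) (a := 1) (b := 1) (c := 1) hM h rfl]
  simp

theorem Extremal1.potCount_eq (h : Extremal1 ts) :
    potCount ts = potBound (ts.map size).sum ∧ (ts.map size).sum % 3 = 1 := by
  obtain ⟨t, rfl, h⟩ := h
  obtain ⟨m, hcount, hsize⟩ := h.exists_potCount_singleton (c := 1) rfl
  rw [show ([leaf, path2].map size).sum = 3 from rfl,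
    (by ring : 3 + 3 * m + 1 = 3 * (m + 1) + 1)] at hsize
  rw [hsize, hcount, potBound_three_mul_add_one]
  omega

theorem IsOrder3Extension.potCount_singleton_eq (h : IsOrder3Extension bs t.children)
    (hbs : leaf.count.attach bs = ⟨.free, 1, 0, 0⟩) (hsum : (bs.map size).sum = 4) :
    potCount [t] = potBound ([t].map size).sum ∧ ([t].map size).sum % 3 = 2 := by
  obtain ⟨m, hcount, hsize⟩ := h.exists_potCount_singleton hbs
  rw [hsum, (by ring : 4 + 3 * m + 1 = 3 * (m + 1) + 2)] at hsize
  rw [hsize, hcount, potBound_three_mul_add_two]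
  omega

theorem potCount_eq_of_perm {i j : ℕ} (hM : AllOrder3 M)
    (h : ts.Perm (List.replicate i leaf ++ (List.replicate j path2 ++ M))) (hij : i + 2 * j = 2) :
    potCount ts = potBound (ts.map size).sum ∧ (ts.map size).sum % 3 = 2 := by
  have hsize : (ts.map size).sum = 3 * M.length + 2 := by
    rw [sum_size_of_perm hM h, hij, add_comm]
  rw [hsize, potBound_three_mul_add_two, potCount_of_perm hM h, zero_pow (by omega)]
  omega

theorem Extremal2.potCount_eq (h : Extremal2 ts) :
    potCount ts = potBound (ts.map size).sum ∧ (ts.map size).sum % 3 = 2 := by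
  obtain ⟨t, rfl, h | h | h⟩ | ⟨M, hM, h⟩ | ⟨M, hM, h⟩ := h
  · exact h.potCount_singleton_eq rfl rfl
  · exact h.potCount_singleton_eq rfl rfl
  · exact h.potCount_singleton_eq rfl rfl
  · exact potCount_eq_of_perm (i := 0) (j := 1) hM h rfl
  · exact potCount_eq_of_perm (i := 2) (j := 0) hM h rfl

end Extremal

section Bound

variable {t : GraftTree} {ts M : List GraftTree} {i j : ℕ}

theorem extremal2_or_potCount_lt_of_size_le_three (h4 : 4 ≤ (ts.map size).sum)
    (hs : ∀ t ∈ ts, t.size ≤ 3) : Extremal2 ts ∨ potCount ts < potBound (ts.map size).sum := by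
  obtain ⟨i, j, M, hM, hp⟩ := exists_perm_of_size_le_three hs
  have hsum := sum_size_of_perm hM hp
  rw [potCount_of_perm hM hp, hsum]
  by_cases h0 : i + j = 0
  · obtain ⟨rfl, rfl⟩ : i = 0 ∧ j = 0 := by omega
    right
    simp only [mul_zero, zero_add, potBound_three_mul, pow_zero]
    omega
  rw [zero_pow h0]
  by_cases h2 : i + 2 * j = 2
  · obtain ⟨rfl, rfl⟩ | ⟨rfl, rfl⟩ : i = 0 ∧ j = 1 ∨ i = 2 ∧ j = 0 := by omega
    · exact .inl (.inr (.inl ⟨M, hM, hp⟩))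
    · exact .inl (.inr (.inr ⟨M, hM, hp⟩))
  · exact .inr (three_pow_lt_potBound (by omega) (by omega))

theorem potCount_lt_of_two_le_length (hs : ¬ ∀ t ∈ ts, t.size ≤ 3) (hl : 2 ≤ ts.length) :
    potCount ts < potBound (ts.map size).sum := by
  have htotal := three_mul_prod_total_le hs
  have hout : 9 * (ts.map fun t => t.count.maxOut).prod ≤ 3 ^ ((ts.map size).sum / 3) :=
    (Nat.mul_le_mul_right _ (Nat.pow_le_pow_right three_pos hl)).trans
      (three_pow_mul_prod_maxOut_le ts)
  have hpos : 0 < 3 ^ ((ts.map size).sum / 3) := by positivity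
  refine lt_of_lt_of_le ?_ (three_pow_div_le_potBound _)
  rw [potCount_eq]
  omega

theorem potCount_singleton_lt_of_not_free (ht : 4 ≤ t.size) (hf : t.count.kind ≠ .free) :
    potCount [t] < potBound t.size := by
  have htotal := (t.three_mul_total_le ht).trans (Nat.mul_le_mul_left 2
    (Nat.pow_le_pow_right three_pos t.exponent_add_totalGain_le))
  have hout : t.count.maxOut = 0 := by
    revert hf
    obtain ⟨_ | _ | _, _, _, _⟩ := t.count <;> simp [RootCount.maxOut]
  have hpos : 0 < 3 ^ (t.size / 3) := by positivity
  refine lt_of_lt_of_le ?_ (three_pow_div_le_potBound _)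
  rw [potCount_singleton, hout]
  omega

theorem potCount_singleton_lt_of_large_child (ht : 4 ≤ t.size) (hf : t.count.kind = .free)
    (hs : ¬ ∀ c ∈ t.children, c.size ≤ 3) : potCount [t] < potBound t.size := by
  have hout := three_mul_out_le_of_large_child hs
  have hexp := t.three_mul_exponent_add_outLoss_le
  have hout_pos := t.count_pos.1
  have hbdd := boundedBy ht
  rw [potCount_singleton]
  generalize t.count = D at *
  obtain ⟨_, a, b, c⟩ := D
  obtain rfl := hf
  obtain ⟨-, -, -, htotal, htotal'⟩ := hbdd
  simp only [RootCount.total, RootCount.maxOut, RootKind.outLoss] at *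
  have he : t.exponent ≠ 0 := fun he => by rw [he] at hout; omega
  obtain h6 | h7 : t.size = 6 ∧ t.exponent = 1 ∨ 7 ≤ t.size := by omega
  · rw [h6.1, potBound_three_mul 2]
    rw [h6.2] at hout htotal
    omega
  · have hpow : 3 ^ (t.exponent + 1) ≤ 3 ^ (t.size / 3) :=
      Nat.pow_le_pow_right three_pos (by omega)
    have hpos : 0 < 3 ^ t.exponent := by positivity
    have htotal' := htotal' h7
    rw [pow_succ] at hpow
    refine lt_of_lt_of_le ?_ (three_pow_div_le_potBound _)
    omega

theorem attach_leaf_of_three_le (hij : 3 ≤ i + 2 * j) (hne : ¬ (i = 1 ∧ j = 1)) :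
    leaf.count.attach (List.replicate i leaf ++ List.replicate j path2) =
      ⟨.free, 1, 0, 0⟩ := by
  have hattach (i j : ℕ) : RootCount.attach ⟨.free, 1, 0, 0⟩
      (List.replicate i leaf ++ List.replicate j path2) = ⟨.free, 1, 0, 0⟩ := by
    rw [RootCount.attach_of_isol_eq_zero]
    simp [show leaf.count.total = 1 from rfl, show path2.count.total = 1 from rfl]
  match i, j with
  | 0, j + 2 => exact hattach 0 j
  | 1, j + 2 => exact hattach 0 j
  | 2, j + 1 => exact hattach 0 j
  | i + 3, j => exact hattach i j
  | 0, 0 | 0, 1 | 1, 0 | 1, 1 | 2, 0 => omega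

theorem extremal2_or_potCount_singleton_lt (hM : AllOrder3 M)
    (hp : t.children.Perm (List.replicate i leaf ++ List.replicate j path2 ++ M))
    (hij : 3 ≤ i + 2 * j) (hne : ¬ (i = 1 ∧ j = 1)) :
    Extremal2 [t] ∨ potCount [t] < potBound t.size := by
  have hsize : t.size = 1 + (i + 2 * j + 3 * M.length) :=
    t.size_eq_children.trans (congrArg _ (sum_size_of_perm hM (List.append_assoc _ _ M ▸ hp)))
  by_cases h4 : i + 2 * j = 4
  · refine .inl (.inl ⟨t, rfl, ?_⟩)
    obtain ⟨rfl, rfl⟩ | ⟨rfl, rfl⟩ | ⟨rfl, rfl⟩ :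
      i = 0 ∧ j = 2 ∨ i = 2 ∧ j = 1 ∨ i = 4 ∧ j = 0 := by omega
    · exact .inl ⟨M, hM, hp⟩
    · exact .inr (.inl ⟨M, hM, hp⟩)
    · exact .inr (.inr ⟨M, hM, hp⟩)
  · right
    rw [potCount_singleton_of_perm hM hp (attach_leaf_of_three_le hij hne), one_mul, zero_mul,
      add_zero]
    exact three_pow_lt_potBound (by omega) (by omega)

theorem extremal_or_potCount_singleton_lt (ht : 4 ≤ t.size) (hf : t.count.kind = .free)
    (hs : ∀ c ∈ t.children, c.size ≤ 3) :
    Extremal0 [t] ∨ Extremal1 [t] ∨ Extremal2 [t] ∨ potCount [t] < potBound t.size := by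
  obtain ⟨i, j, M, hM, hp⟩ := exists_perm_of_size_le_three hs
  have hsize : t.size = 1 + (i + 2 * j + 3 * M.length) :=
    t.size_eq_children.trans (congrArg _ (sum_size_of_perm hM hp))
  rw [← List.append_assoc] at hp
  have hkind : (leaf.count.attach (List.replicate i leaf ++ List.replicate j path2)).kind =
      .free := by
    rw [← hM.kind_attach, ← RootCount.attach_append, ← RootCount.attach_perm _ hp,
      ← count_eq_attach, hf]
  by_cases hij : 3 ≤ i + 2 * j ∧ ¬ (i = 1 ∧ j = 1)
  · exact .inr (.inr (extremal2_or_potCount_singleton_lt hM hp hij.1 hij.2))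
  match i, j with
  | 0, 0 | 1, 0 => nomatch hkind
  | 0, 1 =>
    by_cases hcount : M.count path3 = M.length
    · refine .inl ⟨t, M.length, rfl, ?_⟩
      rwa [List.eq_replicate_iff.2 ⟨rfl, fun s hs => (List.count_eq_length.1 hcount s hs).symm⟩]
        at hp
    · have hlt := (List.count_le_length (a := path3) (l := M)).lt_of_ne hcount
      refine .inr (.inr (.inr ?_))
      rw [potCount_singleton_of_perm (a := 1) (b := 1) (c := 1) hM hp rfl, hsize,
        (by ring : 1 + (0 + 2 * 1 + 3 * M.length) = 3 * (M.length + 1)), potBound_three_mul]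
      omega
  | 2, 0 =>
    refine .inr (.inr (.inr ?_))
    rw [potCount_singleton_of_perm (a := 1) (b := 0) (c := 2) hM hp rfl, hsize,
      (by ring : 1 + (2 + 2 * 0 + 3 * M.length) = 3 * (M.length + 1)), potBound_three_mul]
    omega
  | 1, 1 => exact .inr (.inl ⟨t, rfl, M, hM, hp⟩)
  | 0, j + 2 | 1, j + 2 | 2, j + 1 | i + 3, j => omega

theorem extremal_or_potCount_lt (h : 4 ≤ (ts.map size).sum) :
    Extremal0 ts ∨ Extremal1 ts ∨ Extremal2 ts ∨ potCount ts < potBound (ts.map size).sum := by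
  by_cases hs : ∀ t ∈ ts, t.size ≤ 3
  · exact .inr (.inr (extremal2_or_potCount_lt_of_size_le_three h hs))
  obtain _ | ⟨t, _ | ⟨s, ts⟩⟩ := ts
  · simp at hs
  · rw [List.map_singleton, List.sum_singleton] at h ⊢
    by_cases hf : t.count.kind = .free
    · by_cases hc : ∀ c ∈ t.children, c.size ≤ 3
      · exact extremal_or_potCount_singleton_lt h hf hc
      · exact .inr (.inr (.inr (potCount_singleton_lt_of_large_child h hf hc)))
    · exact .inr (.inr (.inr (potCount_singleton_lt_of_not_free h hf)))
  · exact .inr (.inr (.inr (potCount_lt_of_two_le_length hs (by simp))))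

theorem potCount_le_potBound (h : 4 ≤ (ts.map size).sum) :
    potCount ts ≤ potBound (ts.map size).sum := by
  obtain h | h | h | h := extremal_or_potCount_lt h
  exacts [h.potCount_eq.1.le, h.potCount_eq.1.le, h.potCount_eq.1.le, h.le]

theorem potCount_eq_potBound_iff_extremal0 (h : 4 ≤ (ts.map size).sum)
    (hr : (ts.map size).sum % 3 = 0) :
    potCount ts = potBound (ts.map size).sum ↔ Extremal0 ts := by
  have := extremal_or_potCount_lt h
  grind [Extremal0.potCount_eq, Extremal1.potCount_eq, Extremal2.potCount_eq]

theorem potCount_eq_potBound_iff_extremal1 (h : 4 ≤ (ts.map size).sum)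
    (hr : (ts.map size).sum % 3 = 1) :
    potCount ts = potBound (ts.map size).sum ↔ Extremal1 ts := by
  have := extremal_or_potCount_lt h
  grind [Extremal0.potCount_eq, Extremal1.potCount_eq, Extremal2.potCount_eq]

theorem potCount_eq_potBound_iff_extremal2 (h : 4 ≤ (ts.map size).sum)
    (hr : (ts.map size).sum % 3 = 2) :
    potCount ts = potBound (ts.map size).sum ↔ Extremal2 ts := by
  have := extremal_or_potCount_lt h
  grind [Extremal0.potCount_eq, Extremal1.potCount_eq, Extremal2.potCount_eq]

end Bound

/-! ### Isomorphisms of pointed graphs -/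

/-- Two graphs with distinguished vertices are isomorphic. -/
def PointedIso {V W : Type*} (G : SimpleGraph V) (r : V) (H : SimpleGraph W) (s : W) : Prop :=
  ∃ e : G ≃g H, e r = s

namespace PointedIso

variable {V W U V' W' : Type*} {G : SimpleGraph V} {H : SimpleGraph W} {K : SimpleGraph U}
  {G' : SimpleGraph V'} {H' : SimpleGraph W'} {r : V} {s : W} {t : U} {r' : V'} {s' : W'}

theorem refl (G : SimpleGraph V) (r : V) : PointedIso G r G r := ⟨Iso.refl, rfl⟩

theorem symm (h : PointedIso G r H s) : PointedIso H s G r := by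
  obtain ⟨e, rfl⟩ := h
  exact ⟨e.symm, by simp⟩

theorem trans (h : PointedIso G r H s) (h' : PointedIso H s K t) : PointedIso G r K t := by
  obtain ⟨e, rfl⟩ := h
  obtain ⟨e', rfl⟩ := h'
  exact ⟨e.trans e', rfl⟩

theorem joinByEdge (h : PointedIso G r G' r') (h' : PointedIso H s H' s') :
    PointedIso (joinByEdge G H r s) (Sum.inl r) (joinByEdge G' H' r' s') (Sum.inl r') := by
  obtain ⟨e, rfl⟩ := h
  obtain ⟨e', rfl⟩ := h'
  refine ⟨⟨Equiv.sumCongr e.toEquiv e'.toEquiv, ?_⟩, rfl⟩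
  rintro (a | a) (b | b) <;> simp [e.map_adj_iff, e'.map_adj_iff]

theorem joinByEdge_right_comm (G : SimpleGraph V) (H : SimpleGraph W) (K : SimpleGraph U)
    (r : V) (s : W) (t : U) :
    PointedIso (_root_.joinByEdge (_root_.joinByEdge G H r s) K (Sum.inl r) t)
      (Sum.inl (Sum.inl r)) (_root_.joinByEdge (_root_.joinByEdge G K r t) H (Sum.inl r) s)
      (Sum.inl (Sum.inl r)) := by
  refine ⟨⟨(Equiv.sumAssoc _ _ _).trans (((Equiv.refl _).sumCongr (Equiv.sumComm _ _)).trans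
    (Equiv.sumAssoc _ _ _).symm), ?_⟩, rfl⟩
  rintro ((a | a) | a) ((b | b) | b) <;> simp

end PointedIso

namespace PointedGraph

/-- Two pointed graphs are isomorphic. -/
def Iso (P Q : PointedGraph) : Prop := PointedIso P.graph P.root Q.graph Q.root

variable {P Q R P' Q' : PointedGraph}

theorem Iso.refl (P : PointedGraph) : P.Iso P := PointedIso.refl _ _

theorem Iso.symm (h : P.Iso Q) : Q.Iso P := PointedIso.symm h

theorem Iso.trans (h : P.Iso Q) (h' : Q.Iso R) : P.Iso R := PointedIso.trans h h'

theorem Iso.graft (h : P.Iso P') (h' : Q.Iso Q') : (P.graft Q).Iso (P'.graft Q') :=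
  PointedIso.joinByEdge h h'

theorem graft_right_comm (P Q R : PointedGraph) :
    ((P.graft Q).graft R).Iso ((P.graft R).graft Q) :=
  PointedIso.joinByEdge_right_comm _ _ _ _ _ _

theorem Iso.attach (h : P.Iso Q) (L : List GraftTree) : (P.attach L).Iso (Q.attach L) := by
  induction L generalizing P Q with
  | nil => exact h
  | cons _ _ ih => exact ih (h.graft (Iso.refl _))

theorem attach_perm (P : PointedGraph) {L M : List GraftTree} (h : L.Perm M) :
    (P.attach L).Iso (P.attach M) := by
  induction h generalizing P with
  | nil => exact Iso.refl _
  | cons t _ ih => exact ih _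
  | swap => exact Iso.attach (graft_right_comm _ _ _) _
  | trans _ _ ih ih' => exact (ih P).trans (ih' P)

end PointedGraph

/-! ### Identification of distinguished vertices -/

section Wedge

variable {V W U V' U' : Type*} {G : SimpleGraph V} {H : SimpleGraph W} {K : SimpleGraph U}
  {G' : SimpleGraph V'} {K' : SimpleGraph U'} {r : V} {s : W} {t : U} {r' : V'} {t' : U'}

/-- The graph `K` arises from disjoint copies `f` of `G` and `g` of `H` by identifying
the vertices `r` and `s` to the vertex `t`. -/
structure IsWedge (G : SimpleGraph V) (r : V) (H : SimpleGraph W) (s : W) (K : SimpleGraph U)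
    (t : U) (f : V → U) (g : W → U) : Prop where
  left_injective : Function.Injective f
  right_injective : Function.Injective g
  left_root : f r = t
  right_root : g s = t
  eq_root : ∀ x y, f x = g y → x = r ∧ y = s
  exists_eq : ∀ z, (∃ x, f x = z) ∨ ∃ y, g y = z
  adj_iff : ∀ z z', K.Adj z z' ↔ (∃ x x', G.Adj x x' ∧ f x = z ∧ f x' = z') ∨
    ∃ y y', H.Adj y y' ∧ g y = z ∧ g y' = z'

namespace IsWedge

variable {f : V → U} {g : W → U} {f' : V → U'} {g' : W → U'}

theorem symm (h : IsWedge G r H s K t f g) : IsWedge H s G r K t g f where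
  left_injective := h.right_injective
  right_injective := h.left_injective
  left_root := h.right_root
  right_root := h.left_root
  eq_root x y hxy := (h.eq_root y x hxy.symm).symm
  exists_eq z := (h.exists_eq z).symm
  adj_iff z z' := (h.adj_iff z z').trans or_comm

theorem exists_hom (h : IsWedge G r H s K t f g) (h' : IsWedge G r H s K' t' f' g') :
    ∃ φ : U → U', (∀ x, φ (f x) = f' x) ∧ (∀ y, φ (g y) = g' y) ∧
      ∀ z z', K.Adj z z' → K'.Adj (φ z) (φ z') := by
  have key : ∀ z, ∃ w, (∀ x, f x = z → f' x = w) ∧ ∀ y, g y = z → g' y = w := by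
    intro z
    obtain ⟨x, rfl⟩ | ⟨y, rfl⟩ := h.exists_eq z
    · refine ⟨f' x, fun x' hx' => by rw [h.left_injective hx'], fun y hy => ?_⟩
      obtain ⟨rfl, rfl⟩ := h.eq_root x y hy.symm
      rw [h'.left_root, h'.right_root]
    · refine ⟨g' y, fun x hx => ?_, fun y' hy' => by rw [h.right_injective hy']⟩
      obtain ⟨rfl, rfl⟩ := h.eq_root x y hx
      rw [h'.left_root, h'.right_root]
  choose φ hφ using key
  have hf : ∀ x, φ (f x) = f' x := fun x => ((hφ (f x)).1 x rfl).symm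
  have hg : ∀ y, φ (g y) = g' y := fun y => ((hφ (g y)).2 y rfl).symm
  refine ⟨φ, hf, hg, fun z z' hz => ?_⟩
  rw [h'.adj_iff]
  obtain ⟨x, x', hx, rfl, rfl⟩ | ⟨y, y', hy, rfl, rfl⟩ := (h.adj_iff z z').1 hz
  · exact .inl ⟨x, x', hx, (hf x).symm, (hf x').symm⟩
  · exact .inr ⟨y, y', hy, (hg y).symm, (hg y').symm⟩

theorem pointedIso (h : IsWedge G r H s K t f g) (h' : IsWedge G r H s K' t' f' g') :
    PointedIso K t K' t' := by
  obtain ⟨φ, hf, hg, hadj⟩ := h.exists_hom h'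
  obtain ⟨ψ, hf', hg', hadj'⟩ := h'.exists_hom h
  have hψφ : Function.LeftInverse ψ φ := by
    intro z
    obtain ⟨x, rfl⟩ | ⟨y, rfl⟩ := h.exists_eq z
    · rw [hf, hf']
    · rw [hg, hg']
  have hφψ : Function.RightInverse ψ φ := by
    intro z
    obtain ⟨x, rfl⟩ | ⟨y, rfl⟩ := h'.exists_eq z
    · rw [hf', hf]
    · rw [hg', hg]
  refine ⟨⟨⟨φ, ψ, hψφ, hφψ⟩, fun {a b} => ⟨fun hab => ?_, hadj a b⟩⟩, ?_⟩
  · have hab' : K.Adj (ψ (φ a)) (ψ (φ b)) := hadj' _ _ hab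
    rwa [hψφ, hψφ] at hab'
  · change φ t = t'
    rw [← h.left_root, hf, h'.left_root]

theorem congr_left (h : IsWedge G r H s K t f g) (e : PointedIso G' r' G r) :
    ∃ f', IsWedge G' r' H s K t f' g := by
  obtain ⟨e, he⟩ := e
  refine ⟨fun x => f (e x), ?_, h.right_injective, ?_, h.right_root, ?_, ?_, ?_⟩
  · exact h.left_injective.comp e.injective
  · rw [he, h.left_root]
  · intro x y hxy
    obtain ⟨h1, h2⟩ := h.eq_root _ _ hxy
    exact ⟨e.injective (h1.trans he.symm), h2⟩
  · intro z
    obtain ⟨x, rfl⟩ | h := h.exists_eq z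
    · exact .inl ⟨e.symm x, by simp⟩
    · exact .inr h
  · intro z z'
    rw [h.adj_iff]
    refine or_congr_left ⟨?_, ?_⟩
    · rintro ⟨x, x', hx, rfl, rfl⟩
      exact ⟨e.symm x, e.symm x', e.symm.map_adj_iff.2 hx, by simp, by simp⟩
    · rintro ⟨x, x', hx, rfl, rfl⟩
      exact ⟨e x, e x', e.map_adj_iff.2 hx, rfl, rfl⟩

end IsWedge

theorem isWedge_joinByEdge (G : SimpleGraph V) (H : SimpleGraph W) (r : V) (s : W) :
    IsWedge (joinByEdge (⊥ : SimpleGraph Unit) H () s) (Sum.inl ()) G r (joinByEdge G H r s)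
      (Sum.inl r) (Sum.map (fun _ => r) id) Sum.inl where
  left_injective := by
    rintro (x | x) (y | y) <;> simp
  right_injective := Sum.inl_injective
  left_root := rfl
  right_root := rfl
  eq_root := by
    rintro (x | x) y h
    · simpa [eq_comm] using h
    · simp at h
  exists_eq := by
    rintro (x | x)
    · exact .inr ⟨x, rfl⟩
    · exact .inl ⟨Sum.inr x, rfl⟩
  adj_iff := by
    rintro (x | x) (y | y) <;> simp [eq_comm, and_comm]

theorem isWedge_unit (G : SimpleGraph V) (r : V) :
    IsWedge G r (⊥ : SimpleGraph Unit) () G r id fun _ => r where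
  left_injective := Function.injective_id
  right_injective := fun _ _ _ => rfl
  left_root := rfl
  right_root := rfl
  eq_root := fun _ _ h => ⟨h, rfl⟩
  exists_eq := fun z => .inl ⟨z, rfl⟩
  adj_iff := by simp

theorem IsWedge.joinByEdge {f : V → U} {g : W → U} (h : IsWedge G r H s K t f g)
    (A : SimpleGraph V') (a : V') :
    IsWedge G r (joinByEdge H A s a) (Sum.inl s) (joinByEdge K A t a) (Sum.inl t)
      (fun x => Sum.inl (f x)) (Sum.map g id) where
  left_injective := fun x y hxy => h.left_injective (Sum.inl_injective hxy)
  right_injective := h.right_injective.sumMap Function.injective_id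
  left_root := by rw [h.left_root]
  right_root := by simp [h.right_root]
  eq_root := by
    rintro x (y | y) hxy
    · have := h.eq_root x y (by simpa using hxy)
      simpa using this
    · simp at hxy
  exists_eq := by
    rintro (z | z)
    · obtain ⟨x, rfl⟩ | ⟨y, rfl⟩ := h.exists_eq z
      · exact .inl ⟨x, rfl⟩
      · exact .inr ⟨Sum.inl y, rfl⟩
    · exact .inr ⟨Sum.inr z, rfl⟩
  adj_iff := by
    rintro (z | z) (z' | z')
    · simp [h.adj_iff]
    · simp only [joinByEdge_inl_inr, Sum.exists, Sum.map_inl, Sum.map_inr, id]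
      simp [← h.right_root, eq_comm, and_comm]
    · simp only [joinByEdge_inr_inl, Sum.exists, Sum.map_inl, Sum.map_inr, id]
      simp [← h.right_root, eq_comm, and_comm]
    · simp

theorem glueIncl_root (L : List PointedGraph) (i : Fin L.length) :
    glueIncl L i (L.get i).root = none := dif_pos rfl

theorem glueIncl_of_ne (L : List PointedGraph) (i : Fin L.length) {x : (L.get i).Vert}
    (h : x ≠ (L.get i).root) : glueIncl L i x = some ⟨i, x, h⟩ := dif_neg h

theorem glueIncl_injective (L : List PointedGraph) (i : Fin L.length) :
    Function.Injective (glueIncl L i) := by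
  intro x y h
  by_cases hx : x = (L.get i).root <;> by_cases hy : y = (L.get i).root
  · rw [hx, hy]
  · rw [hx, glueIncl_root, glueIncl_of_ne L i hy] at h
    cases h
  · rw [hy, glueIncl_root, glueIncl_of_ne L i hx] at h
    cases h
  · rw [glueIncl_of_ne L i hx, glueIncl_of_ne L i hy] at h
    simpa using h

theorem glue_adj (L : List PointedGraph) (z z' : GlueVert L) :
    (glue L).graph.Adj z z' ↔ ∃ i x x', (L.get i).graph.Adj x x' ∧ glueIncl L i x = z ∧
      glueIncl L i x' = z' := by
  refine iSup_adj.trans ?_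
  refine exists_congr fun i => ?_
  rw [map_adj']
  constructor
  · exact fun h => h.2
  · rintro ⟨x, x', h, rfl, rfl⟩
    exact ⟨fun hx => h.ne (glueIncl_injective L i hx), x, x', h, rfl, rfl⟩

/-- The map from a glued graph to the graph obtained by gluing one graph more. -/
def glueTail (T : PointedGraph) (L : List PointedGraph) : GlueVert L → GlueVert (T :: L) :=
  Option.map fun p => ⟨Fin.succ p.1, p.2⟩

theorem glueTail_glueIncl (T : PointedGraph) (L : List PointedGraph) (i : Fin L.length)
    (x : (L.get i).Vert) : glueTail T L (glueIncl L i x) = glueIncl (T :: L) i.succ x := by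
  by_cases hx : x = (L.get i).root
  · rw [hx, glueIncl_root]
    exact (glueIncl_root (T :: L) i.succ).symm
  · rw [glueIncl_of_ne L i hx]
    exact (glueIncl_of_ne (T :: L) i.succ hx).symm

theorem eq_root_of_glueIncl_eq_glueTail {T : PointedGraph} {L : List PointedGraph} {x : T.Vert}
    {z : GlueVert L} (h : glueIncl (T :: L) 0 x = glueTail T L z) : x = T.root ∧ z = none := by
  by_cases hx : x = T.root
  · have h' : none = glueTail T L z := by rw [← h, hx]; exact (glueIncl_root (T :: L) 0).symm
    exact ⟨hx, Option.map_eq_none_iff.1 h'.symm⟩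
  · have h' : some ⟨0, x, hx⟩ = glueTail T L z := (glueIncl_of_ne (T :: L) 0 hx).symm.trans h
    obtain ⟨⟨i, y⟩, -, hi⟩ := Option.map_eq_some_iff.1 h'.symm
    exact absurd (congrArg Sigma.fst hi) (Fin.succ_ne_zero i)

theorem glue_cons_adj (T : PointedGraph) (L : List PointedGraph) (z z' : GlueVert (T :: L)) :
    (glue (T :: L)).graph.Adj z z' ↔
      (∃ x x', T.graph.Adj x x' ∧ glueIncl (T :: L) 0 x = z ∧ glueIncl (T :: L) 0 x' = z') ∨
        ∃ y y', (glue L).graph.Adj y y' ∧ glueTail T L y = z ∧ glueTail T L y' = z' := by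
  rw [glue_adj]
  constructor
  · rintro ⟨i, x, x', h, rfl, rfl⟩
    induction i using Fin.cases with
    | zero => exact .inl ⟨x, x', h, rfl, rfl⟩
    | succ i =>
      exact .inr ⟨glueIncl L i x, glueIncl L i x', (glue_adj _ _ _).2 ⟨i, x, x', h, rfl, rfl⟩,
        glueTail_glueIncl _ _ _ _, glueTail_glueIncl _ _ _ _⟩
  · rintro (⟨x, x', h, rfl, rfl⟩ | ⟨y, y', h, rfl, rfl⟩)
    · exact ⟨0, x, x', h, rfl, rfl⟩
    · obtain ⟨i, x, x', hx, rfl, rfl⟩ := (glue_adj _ _ _).1 h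
      exact ⟨i.succ, x, x', hx, (glueTail_glueIncl _ _ _ _).symm,
        (glueTail_glueIncl _ _ _ _).symm⟩

theorem isWedge_glue_cons (T : PointedGraph) (L : List PointedGraph) :
    IsWedge T.graph T.root (glue L).graph (glue L).root (glue (T :: L)).graph
      (glue (T :: L)).root (glueIncl (T :: L) 0) (glueTail T L) where
  left_injective := glueIncl_injective (T :: L) 0
  right_injective := by
    apply Option.map_injective
    rintro ⟨i, x⟩ ⟨j, y⟩ h
    simpa [Sigma.mk.injEq] using h
  left_root := glueIncl_root (T :: L) 0
  right_root := rfl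
  eq_root _ _ h := eq_root_of_glueIncl_eq_glueTail h
  exists_eq := by
    rintro (_ | ⟨i, x, hx⟩)
    · exact .inr ⟨none, rfl⟩
    · induction i using Fin.cases with
      | zero => exact .inl ⟨x, glueIncl_of_ne (T :: L) 0 hx⟩
      | succ i => exact .inr ⟨some ⟨i, x, hx⟩, rfl⟩
  adj_iff := glue_cons_adj T L

end Wedge

/-! ### Glued graphs as trees -/

namespace PointedGraph

/-- The pointed graph `T` consists of a new distinguished vertex, attached to the root of `t`. -/
def IsBranch (T : PointedGraph) (t : GraftTree) : Prop := T.Iso (point.graft t.toPointed)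

theorem glue_nil_iso : (glue []).Iso point := by
  refine ⟨⟨⟨fun _ => (), fun _ => none, ?_, fun _ => rfl⟩, ?_⟩, rfl⟩
  · rintro (_ | ⟨i, _⟩)
    · rfl
    · exact i.elim0
  · rintro (_ | ⟨i, _⟩) (_ | ⟨j, _⟩)
    · constructor <;> intro h
      · exact absurd h (SimpleGraph.irrefl _)
      · exact absurd h (SimpleGraph.irrefl _)
    · exact j.elim0
    · exact i.elim0
    · exact i.elim0

theorem glue_cons_iso {T : PointedGraph} {t : GraftTree} (h : T.IsBranch t)
    (L : List PointedGraph) : (glue (T :: L)).Iso ((glue L).graft t.toPointed) := by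
  obtain ⟨f, hf⟩ := (isWedge_joinByEdge (glue L).graph t.toPointed.graph (glue L).root
    t.toPointed.root).congr_left h
  exact (isWedge_glue_cons T L).pointedIso hf

theorem attach_cons_iso (P : PointedGraph) (t : GraftTree) (ts : List GraftTree) :
    (P.attach (t :: ts)).Iso ((P.attach ts).graft t.toPointed) :=
  P.attach_append_singleton ts t ▸ P.attach_perm (List.perm_append_singleton t ts).symm

theorem glue_iso {L : List PointedGraph} {ts : List GraftTree} (h : List.Forall₂ IsBranch L ts) :
    (glue L).Iso (point.attach ts) := by
  induction h with
  | nil => exact glue_nil_iso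
  | cons hT _ ih =>
    exact (glue_cons_iso hT _).trans ((ih.graft (Iso.refl _)).trans
      (attach_cons_iso _ _ _).symm)

theorem exists_isWedge_attach (P : PointedGraph) (ts : List GraftTree) :
    ∃ f g, IsWedge P.graph P.root (point.attach ts).graph (point.attach ts).root
      (P.attach ts).graph (P.attach ts).root f g := by
  induction ts using List.reverseRecOn with
  | nil => exact ⟨_, _, isWedge_unit P.graph P.root⟩
  | append_singleton ts t ih =>
    obtain ⟨f, g, h⟩ := ih
    rw [attach_append_singleton, attach_append_singleton]
    exact ⟨_, _, h.joinByEdge _ _⟩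

theorem glue_singleton_iso (T : PointedGraph) : (glue [T]).Iso T := by
  obtain ⟨f, hf⟩ := (isWedge_unit T.graph T.root).symm.congr_left glue_nil_iso
  exact (isWedge_glue_cons T []).pointedIso hf.symm

theorem glue_pair_iso (P T : PointedGraph) {ts : List GraftTree} (h : T.Iso (point.attach ts)) :
    (glue [P, T]).Iso (P.attach ts) := by
  obtain ⟨f, g, hw⟩ := exists_isWedge_attach P ts
  obtain ⟨g', hw'⟩ := hw.symm.congr_left ((glue_singleton_iso T).trans h)
  exact (isWedge_glue_cons P [T]).pointedIso hw'.symm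

theorem pointedIso_pathGraph (n : ℕ) : PointedIso (pathGraph (n + 2)) 0
    (joinByEdge (⊥ : SimpleGraph Unit) (pathGraph (n + 1)) () 0) (Sum.inl ()) := by
  refine ⟨⟨⟨fun i => Fin.cases (Sum.inl ()) Sum.inr i, Sum.elim (fun _ => 0) Fin.succ, ?_, ?_⟩, ?_⟩,
    rfl⟩
  · intro i
    induction i using Fin.cases <;> rfl
  · rintro (i | i) <;> rfl
  · intro i j
    induction i using Fin.cases with
    | zero =>
      induction j using Fin.cases with
      | zero => simp
      | succ j =>
        refine joinByEdge_inl_inr.trans ?_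
        rw [pathGraph_adj, Fin.ext_iff, Fin.val_succ]
        simp only [Fin.val_zero, true_and]
        omega
    | succ i =>
      induction j using Fin.cases with
      | zero =>
        refine joinByEdge_inr_inl.trans ?_
        rw [pathGraph_adj, Fin.ext_iff, Fin.val_succ]
        simp only [Fin.val_zero, true_and]
        omega
      | succ j =>
        refine joinByEdge_inr_inr.trans ?_
        rw [pathGraph_adj, pathGraph_adj]
        change ((i : ℕ) + 1 = j ∨ (j : ℕ) + 1 = i) ↔
          (i : ℕ) + 1 + 1 = (j : ℕ) + 1 ∨ (j : ℕ) + 1 + 1 = (i : ℕ) + 1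
        omega

theorem leafPath_iso (n : ℕ) : (leafPath (n + 2)).Iso (point.graft (leafPath (n + 1))) :=
  pointedIso_pathGraph n

theorem leafPath_one_iso : (leafPath 1).Iso point := by
  have : PointedIso (pathGraph 1) 0 (⊥ : SimpleGraph Unit) () := by
    refine ⟨⟨Equiv.ofUnique _ _, ?_⟩, rfl⟩
    intro i j
    simp [pathGraph_adj]
  exact this

theorem leafPath_two_isBranch : (leafPath 2).IsBranch leaf :=
  (leafPath_iso 0).trans ((Iso.refl _).graft leafPath_one_iso)

theorem leafPath_three_isBranch : (leafPath 3).IsBranch path2 :=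
  (leafPath_iso 1).trans ((Iso.refl _).graft leafPath_two_isBranch)

theorem leafPath_four_isBranch : (leafPath 4).IsBranch path3 :=
  (leafPath_iso 2).trans ((Iso.refl _).graft leafPath_three_isBranch)

theorem leafClaw_isBranch : leafClaw.IsBranch cherry := by
  have : PointedIso (completeBipartiteGraph (Fin 1) (Fin 3)) (Sum.inr 0)
      (joinByEdge (⊥ : SimpleGraph Unit) (joinByEdge (joinByEdge (⊥ : SimpleGraph Unit)
        (⊥ : SimpleGraph Unit) () ()) (⊥ : SimpleGraph Unit) (Sum.inl ()) ()) ()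
        (Sum.inl (Sum.inl ()))) (Sum.inl ()) := by
    refine ⟨⟨⟨Sum.elim (fun _ => Sum.inr (Sum.inl (Sum.inl ())))
      ![Sum.inl (), Sum.inr (Sum.inl (Sum.inr ())), Sum.inr (Sum.inr ())],
      Sum.elim (fun _ => Sum.inr 0) (Sum.elim (Sum.elim (fun _ => Sum.inl 0) fun _ => Sum.inr 1)
        fun _ => Sum.inr 2), ?_, ?_⟩, ?_⟩, rfl⟩
    · rintro (i | i)
      · simp [Subsingleton.elim i 0]
      · fin_cases i <;> rfl
    · rintro (i | ((i | i) | i)) <;> rfl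
    · rintro (i | i) (j | j)
      · simp
      · fin_cases j <;> simp
      · fin_cases i <;> simp
      · fin_cases i <;> fin_cases j <;> simp
  exact this

theorem forall₂_isBranch_replicate (m : ℕ) :
    List.Forall₂ IsBranch (List.replicate m (leafPath 4)) (List.replicate m path3) := by
  induction m with
  | zero => exact .nil
  | succ m ih => exact .cons leafPath_four_isBranch ih

theorem exists_forall₂ {α β : Type*} {R : α → β → Prop} {p : β → Prop} {l : List α}
    (h : ∀ a ∈ l, ∃ b, p b ∧ R a b) : ∃ m, (∀ b ∈ m, p b) ∧ List.Forall₂ R l m := by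
  induction l with
  | nil => exact ⟨[], by simp, .nil⟩
  | cons a l ih =>
    rw [List.forall_mem_cons] at h
    obtain ⟨⟨b, hb, hab⟩, hl⟩ := h
    obtain ⟨m, hm, hlm⟩ := ih hl
    exact ⟨b :: m, List.forall_mem_cons.2 ⟨hb, hm⟩, .cons hab hlm⟩

theorem exists_forall₂_of_allP4OrClaw {L : List PointedGraph} (hL : AllP4OrClaw L) :
    ∃ M, AllOrder3 M ∧ List.Forall₂ IsBranch L M := by
  refine exists_forall₂ fun T hT => ?_
  obtain rfl | rfl := hL T hT
  · exact ⟨path3, .inl rfl, leafPath_four_isBranch⟩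
  · exact ⟨cherry, .inr rfl, leafClaw_isBranch⟩

theorem exists_forall₂_of_allOrder3 {M : List GraftTree} (hM : AllOrder3 M) :
    ∃ L, AllP4OrClaw L ∧ List.Forall₂ IsBranch L M := by
  have h : ∀ t ∈ M, ∃ T, (T = leafPath 4 ∨ T = leafClaw) ∧ flip IsBranch t T := by
    intro t ht
    obtain rfl | rfl := hM t ht
    · exact ⟨leafPath 4, .inl rfl, leafPath_four_isBranch⟩
    · exact ⟨leafClaw, .inr rfl, leafClaw_isBranch⟩
  obtain ⟨L, hL, hML⟩ := exists_forall₂ h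
  exact ⟨L, hL, hML.flip⟩

end PointedGraph

/-! ### Decomposition of graphs along bridges -/

theorem GraftTree.exists_children_eq (ts : List GraftTree) : ∃ t : GraftTree, t.children = ts := by
  induction ts using List.reverseRecOn with
  | nil => exact ⟨leaf, rfl⟩
  | append_singleton ts t ih =>
    obtain ⟨s, rfl⟩ := ih
    exact ⟨s.graft t, rfl⟩

section Decomposition

variable {V : Type u} {G : SimpleGraph V}

theorem isBridge_induce {a b : V} (h : G.IsBridge s(a, b)) {A : Set V} (ha : a ∈ A)
    (hb : b ∈ A) : (G.induce A).IsBridge s(⟨a, ha⟩, ⟨b, hb⟩) := by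
  rw [isBridge_iff_forall_walk_mem_edges] at h ⊢
  intro p
  let φ : G.induce A →g G := ⟨Subtype.val, id⟩
  have hp := h (p.map φ)
  rw [Walk.edges_map, List.mem_map] at hp
  obtain ⟨e, he, hab⟩ := hp
  have hab : Sym2.map (Subtype.val : A → V) e = Sym2.map Subtype.val s(⟨a, ha⟩, ⟨b, hb⟩) := hab
  rwa [← Sym2.map.injective Subtype.val_injective hab]

theorem connected_induce_reachable {H : SimpleGraph V} (hHG : H ≤ G) (s : V) :
    (G.induce {x | H.Reachable s x}).Connected := by
  have hs : {x | H.Reachable s x} = (H.connectedComponentMk s).supp := by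
    ext x
    rw [ConnectedComponent.mem_supp_iff, ConnectedComponent.eq, reachable_comm]
    rfl
  rw [hs]
  exact (H.connectedComponentMk s).connected_toSimpleGraph.mono fun _ _ h => hHG h

theorem reachable_deleteEdges_or (hG : G.Connected) (w v x : V) :
    (G.deleteEdges {s(w, v)}).Reachable w x ∨ (G.deleteEdges {s(w, v)}).Reachable v x := by
  induction (reachable_iff_reflTransGen w x).1 (hG.preconnected w x) with
  | refl => exact .inl (Reachable.refl w)
  | @tail y z _ hyz ih =>
    by_cases he : s(y, z) = s(w, v)
    · rw [Sym2.eq_iff] at he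
      obtain ⟨-, rfl⟩ | ⟨-, rfl⟩ := he
      · exact .inr (Reachable.refl _)
      · exact .inl (Reachable.refl _)
    · have hyz' : (G.deleteEdges {s(w, v)}).Reachable y z :=
        (deleteEdges_adj.2 ⟨hyz, he⟩).reachable
      exact ih.imp (·.trans hyz') (·.trans hyz')

theorem adj_iff_of_isBridge {w v a b : V} (hadj : G.Adj w v) (hwv : G.IsBridge s(w, v))
    (ha : (G.deleteEdges {s(w, v)}).Reachable w a)
    (hb : (G.deleteEdges {s(w, v)}).Reachable v b) : G.Adj a b ↔ a = w ∧ b = v := by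
  rw [isBridge_iff] at hwv
  refine ⟨fun hab => ?_, fun h => h.1 ▸ h.2 ▸ hadj⟩
  by_cases he : s(a, b) = s(w, v)
  · rw [Sym2.eq_iff] at he
    obtain h | ⟨rfl, rfl⟩ := he
    · exact h
    · exact absurd ha hwv
  · have hab' : (G.deleteEdges {s(w, v)}).Reachable a b :=
      (deleteEdges_adj.2 ⟨hab, he⟩).reachable
    exact absurd (ha.trans (hab'.trans hb.symm)) hwv

theorem pointedIso_joinByEdge_of_isBridge (hG : G.Connected) {w v : V} (hadj : G.Adj w v)
    (hwv : G.IsBridge s(w, v)) :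
    PointedIso G w
      (joinByEdge (G.induce {x | (G.deleteEdges {s(w, v)}).Reachable w x})
        (G.induce {x | (G.deleteEdges {s(w, v)}).Reachable v x})
        ⟨w, Reachable.refl w⟩ ⟨v, Reachable.refl v⟩)
      (Sum.inl ⟨w, Reachable.refl w⟩) := by
  have hdisj : ∀ x, (G.deleteEdges {s(w, v)}).Reachable w x →
      ¬ (G.deleteEdges {s(w, v)}).Reachable v x :=
    fun x hwx hvx => isBridge_iff.1 hwv (hwx.trans hvx.symm)
  apply PointedIso.symm
  refine ⟨⟨Equiv.ofBijective (Sum.elim Subtype.val Subtype.val) ⟨?_, ?_⟩, ?_⟩, rfl⟩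
  · rintro (⟨a, ha⟩ | ⟨a, ha⟩) (⟨b, hb⟩ | ⟨b, hb⟩) hab <;>
      simp only [Sum.elim_inl, Sum.elim_inr] at hab <;> subst hab
    · rfl
    · exact absurd hb (hdisj _ ha)
    · exact absurd ha (hdisj _ hb)
    · rfl
  · intro x
    obtain h | h := reachable_deleteEdges_or hG w v x
    · exact ⟨Sum.inl ⟨x, h⟩, rfl⟩
    · exact ⟨Sum.inr ⟨x, h⟩, rfl⟩
  · rintro (⟨a, ha⟩ | ⟨a, ha⟩) (⟨b, hb⟩ | ⟨b, hb⟩)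
    · simp
    · simpa using adj_iff_of_isBridge hadj hwv ha hb
    · simpa [G.adj_comm a b] using adj_iff_of_isBridge hadj hwv hb ha
    · simp

theorem pointedIso_induce_induce {A K : Set V} (hKA : K ⊆ A) {w : V} (hw : w ∈ K) :
    PointedIso ((G.induce A).induce (Subtype.val ⁻¹' K : Set A)) ⟨⟨w, hKA hw⟩, hw⟩
      (G.induce K) ⟨w, hw⟩ :=
  ⟨⟨⟨fun x => ⟨x.1.1, x.2⟩, fun x => ⟨⟨x.1, hKA x.2⟩, x.2⟩, fun _ => rfl, fun _ => rfl⟩, Iff.rfl⟩,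
    rfl⟩

theorem pointedIso_induce_singleton (v : V) :
    PointedIso (G.induce {v}) ⟨v, rfl⟩ (⊥ : SimpleGraph Unit) () := by
  refine ⟨⟨Equiv.ofUnique _ _, ?_⟩, rfl⟩
  rintro ⟨a, rfl⟩ ⟨b, rfl⟩
  simp

/-- The connected graph `G` consists of a connected part `K` and of trees attached to the vertex
`w` of `K`: the edges outside `K` are bridges, and those that leave `K` start at `w`. -/
structure IsCoreAt (G : SimpleGraph V) (K : Set V) (w : V) : Prop where
  mem : w ∈ K
  connected : G.Connected
  connected_core : (G.induce K).Connected
  eq_of_adj : ∀ a ∈ K, ∀ b ∉ K, G.Adj a b → a = w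
  isBridge : ∀ a b, G.Adj a b → ¬ (a ∈ K ∧ b ∈ K) → G.IsBridge s(a, b)

namespace IsCoreAt

variable {K A : Set V} {w v : V}

theorem exists_adj (h : IsCoreAt G K w) (hK : K ≠ Set.univ) : ∃ v ∉ K, G.Adj w v := by
  obtain ⟨x, hx⟩ := (Set.ne_univ_iff_exists_notMem K).1 hK
  obtain ⟨p⟩ := h.connected.preconnected w x
  obtain ⟨d, -, hfst, hsnd⟩ := p.exists_boundary_dart K h.mem hx
  exact ⟨d.snd, hsnd, h.eq_of_adj _ hfst _ hsnd d.adj ▸ d.adj⟩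

theorem subset_reachable (h : IsCoreAt G K w) (hv : v ∉ K) :
    K ⊆ {x | (G.deleteEdges {s(w, v)}).Reachable w x} := by
  intro y hy
  have hwy := h.connected_core.preconnected ⟨w, h.mem⟩ ⟨y, hy⟩
  refine hwy.map (G' := G.deleteEdges {s(w, v)}) ⟨Subtype.val, ?_⟩
  rintro ⟨a, ha⟩ ⟨b, hb⟩ hab
  refine deleteEdges_adj.2 ⟨hab, fun he => ?_⟩
  rw [Set.mem_singleton_iff, Sym2.eq_iff] at he
  obtain ⟨-, rfl⟩ | ⟨rfl, -⟩ := he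
  · exact hv hb
  · exact hv ha

theorem induce (h : IsCoreAt G K w) (hKA : K ⊆ A) (hA : (G.induce A).Connected) :
    IsCoreAt (G.induce A) (Subtype.val ⁻¹' K) ⟨w, hKA h.mem⟩ where
  mem := h.mem
  connected := hA
  connected_core := by
    obtain ⟨e, -⟩ := pointedIso_induce_induce (G := G) hKA h.mem
    exact e.connected_iff.2 h.connected_core
  eq_of_adj a ha b hb hab := Subtype.ext (h.eq_of_adj a ha b hb hab)
  isBridge a b hab hK := isBridge_induce (h.isBridge a b hab hK) a.2 b.2

theorem induce_of_disjoint (h : IsCoreAt G K w) (hKA : Disjoint A K) (hA : (G.induce A).Connected)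
    (v : A) : IsCoreAt (G.induce A) {v} v where
  mem := rfl
  connected := hA
  connected_core := connected_iff_exists_forall_reachable _ |>.2
    ⟨⟨v, rfl⟩, fun x => Subsingleton.elim ⟨v, rfl⟩ x ▸ Reachable.refl _⟩
  eq_of_adj _ ha _ _ _ := ha
  isBridge a b hab _ := isBridge_induce
    (h.isBridge a b hab fun hK => hKA.notMem_of_mem_left a.2 hK.1) a.2 b.2

theorem exists_pointedIso_attach (N : ℕ) {V : Type u} [Finite V] (hN : Nat.card V ≤ N)
    {G : SimpleGraph V} {K : Set V} {w : V} (h : IsCoreAt G K w) {P : PointedGraph}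
    (hP : PointedIso (G.induce K) ⟨w, h.mem⟩ P.graph P.root) :
    ∃ ts, PointedIso G w (P.attach ts).graph (P.attach ts).root := by
  induction N generalizing V P with
  | zero =>
    have : Nonempty V := ⟨w⟩
    exact absurd hN Nat.card_pos.not_ge
  | succ N ih =>
    by_cases hK : K = Set.univ
    · subst hK
      exact ⟨[], PointedIso.trans (PointedIso.symm ⟨induceUnivIso G, rfl⟩) hP⟩
    obtain ⟨v, hv, hadj⟩ := h.exists_adj hK
    have hwv := h.isBridge w v hadj fun hK => hv hK.2
    have hdis := isBridge_iff.1 hwv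
    have hKA := h.subset_reachable hv
    set G' := G.deleteEdges {s(w, v)}
    have hBK : Disjoint {x | G'.Reachable v x} K :=
      Set.disjoint_left.2 fun y hy hyK => hdis ((hKA hyK).trans hy.symm)
    have hcardA : Nat.card {x | G'.Reachable w x} < Nat.card V :=
      Finite.card_subtype_lt (x := v) hdis
    have hcardB : Nat.card {x | G'.Reachable v x} < Nat.card V :=
      Finite.card_subtype_lt (x := w) fun h => hdis h.symm
    have hle : G' ≤ G := deleteEdges_le _
    obtain ⟨ts, hts⟩ := ih (by omega) (h.induce hKA (connected_induce_reachable hle w))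
      ((pointedIso_induce_induce hKA h.mem).trans hP)
    obtain ⟨us, hus⟩ := ih (by omega)
      (h.induce_of_disjoint hBK (connected_induce_reachable hle v) ⟨v, Reachable.refl v⟩)
      (P := PointedGraph.point) (pointedIso_induce_singleton _)
    obtain ⟨t, rfl⟩ := exists_children_eq us
    refine ⟨ts ++ [t], (pointedIso_joinByEdge_of_isBridge h.connected hadj hwv).trans ?_⟩
    rw [PointedGraph.attach_append_singleton, toPointed_eq_attach]
    exact hts.joinByEdge hus

end IsCoreAt

end Decomposition

/-! ### Potted graphs are cycles with trees attached at one vertex -/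

theorem cycleGraph_adj_iff_val {m : ℕ} (hm : 3 ≤ m) (i j : Fin m) :
    (cycleGraph m).Adj i j ↔ j.val = i.val + 1 ∨ i.val = j.val + 1 ∨
      (i.val = 0 ∧ j.val + 1 = m) ∨ (j.val = 0 ∧ i.val + 1 = m) := by
  obtain ⟨i, hi⟩ := i
  obtain ⟨j, hj⟩ := j
  simp only [cycleGraph_adj', Fin.sub_def]
  rcases lt_or_ge i j with h | h
  · rw [Nat.mod_eq_of_lt (by omega : m - j + i < m),
      (by omega : m - i + j = j - i + m), Nat.add_mod_right, Nat.mod_eq_of_lt (by omega)]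
    omega
  · rw [(by omega : m - j + i = i - j + m), Nat.add_mod_right, Nat.mod_eq_of_lt (by omega)]
    rcases h.eq_or_lt with rfl | h
    · rw [Nat.sub_add_cancel hi.le, Nat.mod_self]
      omega
    · rw [Nat.mod_eq_of_lt (by omega)]
      omega

section UniqueCycle

variable {V : Type u} {G : SimpleGraph V} {v : V} {p : G.Walk v v}

theorem toSubgraph_adj_of_unique_cycle
    (hu : ∀ (x : V) (q : G.Walk x x), q.IsCycle → q.toSubgraph = p.toSubgraph) {a b : V}
    (ha : a ∈ p.toSubgraph.verts) (hb : b ∈ p.toSubgraph.verts) (hab : G.Adj a b) :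
    p.toSubgraph.Adj a b := by
  by_contra hn
  have hreach : (G.deleteEdges {s(a, b)}).Reachable a b := by
    refine (p.toSubgraph_connected.preconnected ⟨a, ha⟩ ⟨b, hb⟩).map
      (G' := G.deleteEdges {s(a, b)}) ⟨Subtype.val, ?_⟩
    rintro ⟨x, hx⟩ ⟨y, hy⟩ (hxy : p.toSubgraph.Adj x y)
    refine deleteEdges_adj.2 ⟨hxy.adj_sub, fun he => hn ?_⟩
    rw [Set.mem_singleton_iff, Sym2.eq_iff] at he
    obtain ⟨rfl, rfl⟩ | ⟨rfl, rfl⟩ := he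
    · exact hxy
    · exact hxy.symm
  obtain ⟨x, q, hq, he⟩ := adj_and_reachable_delete_edges_iff_exists_cycle.1 ⟨hab, hreach⟩
  rw [← Walk.adj_toSubgraph_iff_mem_edges, hu x q hq] at he
  exact hn he

theorem isBridge_of_unique_cycle
    (hu : ∀ (x : V) (q : G.Walk x x), q.IsCycle → q.toSubgraph = p.toSubgraph) {a b : V}
    (hab : G.Adj a b) (h : ¬ (a ∈ p.toSubgraph.verts ∧ b ∈ p.toSubgraph.verts)) :
    G.IsBridge s(a, b) := by
  rw [isBridge_iff_forall_cycle_notMem hab]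
  intro x q hq he
  rw [← Walk.adj_toSubgraph_iff_mem_edges, hu x q hq] at he
  exact h ⟨he.fst_mem, he.snd_mem⟩

theorem two_lt_ncard_neighborSet_of_isCycle [Finite V] (hp : p.IsCycle) {a b : V}
    (ha : a ∈ p.toSubgraph.verts) (hb : b ∉ p.toSubgraph.verts) (hab : G.Adj a b) :
    2 < (G.neighborSet a).ncard := by
  rw [← hp.ncard_neighborSet_toSubgraph_eq_two (p.mem_verts_toSubgraph.1 ha)]
  refine Set.ncard_lt_ncard ⟨p.toSubgraph.neighborSet_subset a, fun h => hb ?_⟩ (Set.toFinite _)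
  have hab' : p.toSubgraph.Adj a b := h hab
  exact hab'.snd_mem

theorem getVert_eq_getVert_iff_of_isCycle (hp : p.IsCycle) {i j : ℕ} (hi : i < p.length)
    (hj : j < p.length) : p.getVert i = p.getVert j ↔ i = j :=
  ⟨fun h => hp.getVert_injOn' (Nat.le_sub_one_of_lt hi) (Nat.le_sub_one_of_lt hj) h,
    congrArg p.getVert⟩

theorem getVert_succ_eq_getVert_iff_of_isCycle (hp : p.IsCycle) {i j : ℕ} (hi : i < p.length)
    (hj : j < p.length) :
    p.getVert (i + 1) = p.getVert j ↔ i + 1 = j ∨ i + 1 = p.length ∧ j = 0 := by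
  rcases Nat.lt_or_ge (i + 1) p.length with h | h
  · rw [getVert_eq_getVert_iff_of_isCycle hp h hj]
    omega
  · have hlen : i + 1 = p.length := by omega
    have hend : p.getVert (i + 1) = p.getVert 0 := by
      rw [hlen, p.getVert_length, p.getVert_zero]
    rw [hend, getVert_eq_getVert_iff_of_isCycle hp (by omega) hj]
    omega

theorem toSubgraph_adj_getVert_iff (hp : p.IsCycle) (i j : Fin p.length) :
    p.toSubgraph.Adj (p.getVert i) (p.getVert j) ↔ (cycleGraph p.length).Adj i j := by
  have hstep : ∀ l < p.length, s(p.getVert l, p.getVert (l + 1)) = s(p.getVert i, p.getVert j) ↔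
      l = i ∧ (l + 1 = j ∨ l + 1 = p.length ∧ j.val = 0) ∨
        l = j ∧ (l + 1 = i ∨ l + 1 = p.length ∧ i.val = 0) := by
    intro l hl
    rw [Sym2.eq_iff, getVert_eq_getVert_iff_of_isCycle hp hl i.2,
      getVert_eq_getVert_iff_of_isCycle hp hl j.2,
      getVert_succ_eq_getVert_iff_of_isCycle hp hl i.2,
      getVert_succ_eq_getVert_iff_of_isCycle hp hl j.2]
  rw [cycleGraph_adj_iff_val hp.three_le_length, Walk.toSubgraph_adj_iff]
  constructor
  · rintro ⟨l, h, hl⟩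
    rw [hstep l hl] at h
    omega
  · rintro (h | h | h | h)
    · exact ⟨i, (hstep i i.2).2 (by omega), i.2⟩
    · exact ⟨j, (hstep j j.2).2 (by omega), j.2⟩
    · exact ⟨j, (hstep j j.2).2 (by omega), j.2⟩
    · exact ⟨i, (hstep i i.2).2 (by omega), i.2⟩

theorem exists_iso_cycleGraph_of_unique_cycle (hp : p.IsCycle)
    (hu : ∀ (x : V) (q : G.Walk x x), q.IsCycle → q.toSubgraph = p.toSubgraph) :
    Nonempty (cycleGraph p.length ≃g G.induce p.toSubgraph.verts) := by
  have hmem : ∀ i, p.getVert i ∈ p.toSubgraph.verts := fun i =>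
    p.mem_verts_toSubgraph.2 (p.getVert_mem_support i)
  refine ⟨⟨Equiv.ofBijective (fun i : Fin p.length => ⟨p.getVert i, hmem i⟩) ⟨?_, ?_⟩, ?_⟩⟩
  · intro i j h
    exact Fin.ext ((getVert_eq_getVert_iff_of_isCycle hp i.2 j.2).1 (congrArg Subtype.val h))
  · rintro ⟨x, hx⟩
    obtain ⟨i, rfl, hi⟩ := (Walk.mem_support_iff_exists_getVert).1 (p.mem_verts_toSubgraph.1 hx)
    rcases hi.eq_or_lt with rfl | hi
    · exact ⟨⟨0, Nat.zero_lt_of_lt hp.three_le_length⟩, Subtype.ext (by simp)⟩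
    · exact ⟨⟨i, hi⟩, rfl⟩
  · intro i j
    rw [← toSubgraph_adj_getVert_iff hp]
    exact ⟨toSubgraph_adj_of_unique_cycle hu (hmem i) (hmem j), fun h => h.adj_sub⟩

end UniqueCycle

/-- The cycle `C_k` with a distinguished vertex. -/
def pointedCycle (k : ℕ) (c : Fin k) : PointedGraph := ⟨Fin k, cycleGraph k, c⟩

theorem IsPotted.exists_iso_attach {V : Type u} [Fintype V] {G : SimpleGraph V} {n k : ℕ}
    (h : IsPotted G n k) : 3 ≤ k ∧ ∃ (c : Fin k) (ts : List GraftTree),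
      Nonempty (G ≃g ((pointedCycle k c).attach ts).graph) := by
  obtain ⟨-, hconn, C, ⟨v, p, hp, rfl⟩, huniq, hk, w, ⟨hw, -⟩, hw'⟩ := h
  have hu : ∀ (x : V) (q : G.Walk x x), q.IsCycle → q.toSubgraph = p.toSubgraph :=
    fun x q hq => huniq _ ⟨x, q, hq, rfl⟩
  obtain ⟨e⟩ := exists_iso_cycleGraph_of_unique_cycle hp hu
  have hlen : p.length = k := by
    rw [← hk, ← Nat.card_coe_set_eq, ← Nat.card_congr e.toEquiv, Nat.card_fin]
  subst hlen
  have hcore : IsCoreAt G p.toSubgraph.verts w :=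
    { mem := hw
      connected := hconn
      connected_core := p.toSubgraph_connected.induce_verts
      eq_of_adj := fun a ha b hb hab =>
        hw' a ⟨ha, two_lt_ncard_neighborSet_of_isCycle hp ha hb hab⟩
      isBridge := fun _ _ hab h => isBridge_of_unique_cycle hu hab h }
  obtain ⟨ts, e', -⟩ := hcore.exists_pointedIso_attach (Nat.card V) le_rfl
    (P := pointedCycle p.length (e.symm ⟨w, hw⟩)) ⟨e.symm, rfl⟩
  exact ⟨hp.three_le_length, _, ts, ⟨e'⟩⟩

/-! ### Maximum dissociation sets of a cycle -/

section Windows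

variable {n : ℕ} [NeZero n]

theorem cycleGraph_adj_add_one (hn : 2 ≤ n) (i : Fin n) : (cycleGraph n).Adj i (i + 1) := by
  obtain ⟨n, rfl⟩ := Nat.exists_eq_add_of_le' hn
  simp [cycleGraph_adj]

/-- The number of members of `S` among three consecutive vertices of a cycle, the first of which
is `i`. -/
def windowCount (S : Finset (Fin n)) (i : Fin n) : ℕ :=
  (if i ∈ S then 1 else 0) + (if i + 1 ∈ S then 1 else 0) + (if i + 1 + 1 ∈ S then 1 else 0)

theorem sum_windowCount (S : Finset (Fin n)) : ∑ i, windowCount S i = 3 * S.card := by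
  have hshift : ∀ f : Fin n → ℕ, ∑ i, f (i + 1) = ∑ i, f i :=
    Equiv.sum_comp (Equiv.addRight 1)
  have hcard : ∑ i, (if i ∈ S then 1 else 0) = S.card := by simp
  simp only [windowCount, Finset.sum_add_distrib]
  rw [hshift fun i => if i + 1 ∈ S then 1 else 0, hshift fun i => if i ∈ S then 1 else 0, hcard]
  ring

theorem windowCount_le_two (hn : 3 ≤ n) {S : Finset (Fin n)}
    (hS : IsDissociationSet (cycleGraph n) S) (i : Fin n) : windowCount S i ≤ 2 := by
  have hne : i ≠ i + 1 + 1 := by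
    rw [Ne, add_assoc, left_eq_add, Fin.ext_iff, Fin.val_add, Fin.val_zero, Fin.val_one',
      Nat.mod_eq_of_lt (by omega : 1 < n), Nat.mod_eq_of_lt hn]
    exact two_ne_zero
  have hnot : ¬(i ∈ S ∧ i + 1 ∈ S ∧ i + 1 + 1 ∈ S) := fun ⟨h0, h1, h2⟩ =>
    hne (isDissociationSet_iff.1 hS _ h1 _ h0 _ h2
      (cycleGraph_adj_add_one (by omega) i).symm (cycleGraph_adj_add_one (by omega) (i + 1)))
  rw [windowCount]
  grind

theorem three_mul_card_le_of_isDissociationSet_cycleGraph (hn : 3 ≤ n) {S : Finset (Fin n)}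
    (hS : IsDissociationSet (cycleGraph n) S) : 3 * S.card ≤ 2 * n := by
  rw [← sum_windowCount]
  refine (Finset.sum_le_card_nsmul _ _ 2 fun i _ => windowCount_le_two hn hS i).trans ?_
  simp [mul_comm]

theorem windowCount_eq_two (hn : 3 ≤ n) {S : Finset (Fin n)}
    (hS : IsDissociationSet (cycleGraph n) S) (hcard : 3 * S.card = 2 * n) (i : Fin n) :
    windowCount S i = 2 := by
  refine (Finset.sum_eq_sum_iff_of_le fun i _ => windowCount_le_two hn hS i).1 ?_ i
    (Finset.mem_univ i)
  rw [sum_windowCount, hcard]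
  simp [mul_comm]

theorem exists_residue_of_windowCount_eq_two {S : Finset (Fin n)} (h : ∀ i, windowCount S i = 2) :
    ∃ j < 3, ∀ i : Fin n, i ∈ S ↔ i.val % 3 ≠ j := by
  obtain ⟨g, hg⟩ : ∃ g : ℕ → Prop, ∀ a, g a ↔ Fin.ofNat n a ∈ S := ⟨_, fun _ => Iff.rfl⟩
  have hsucc : ∀ a, Fin.ofNat n (a + 1) = Fin.ofNat n a + 1 := fun a => by
    ext
    simp [Fin.val_add]
  have hwin : ∀ a, (g a ∧ g (a + 1) ∧ ¬g (a + 2)) ∨ (g a ∧ ¬g (a + 1) ∧ g (a + 2)) ∨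
      (¬g a ∧ g (a + 1) ∧ g (a + 2)) := fun a => by
    have hwin := h (Fin.ofNat n a)
    rw [windowCount, ← hsucc, ← hsucc] at hwin
    simp only [hg]
    grind
  have hper : Function.Periodic g 3 := fun a => by
    have := hwin a
    have := hwin (a + 1)
    grind
  have hmem : ∀ i : Fin n, i ∈ S ↔ g (i.val % 3) := fun i => by
    rw [hper.map_mod_nat, hg, Fin.ofNat_val_eq_self]
  obtain ⟨j, hj, hgj⟩ : ∃ j < 3, ∀ a < 3, g a ↔ a ≠ j := by
    rcases hwin 0 with h0 | h0 | h0
    · exact ⟨2, by omega, fun a ha => by interval_cases a <;> simp [h0]⟩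
    · exact ⟨1, by omega, fun a ha => by interval_cases a <;> simp [h0]⟩
    · exact ⟨0, by omega, fun a ha => by interval_cases a <;> simp [h0]⟩
  exact ⟨j, hj, fun i => (hmem i).trans (hgj _ (Nat.mod_lt _ three_pos))⟩

end Windows

section Cycle

variable {m : ℕ} [NeZero m]

theorem val_add_one_mod_three (i : Fin (3 * m)) : (i + 1).val % 3 = (i.val + 1) % 3 := by
  rw [Fin.val_add, Fin.val_one', Nat.mod_mul_right_mod, Nat.add_mod, Nat.mod_mul_right_mod,
    ← Nat.add_mod]

/-- The vertices of the cycle of order `3 * m` outside the residue class of `j` modulo three. -/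
def residueSet (m j : ℕ) : Finset (Fin (3 * m)) := Finset.univ.filter fun i => i.val % 3 ≠ j

@[simp] theorem mem_residueSet {m j : ℕ} {i : Fin (3 * m)} :
    i ∈ residueSet m j ↔ i.val % 3 ≠ j := by simp [residueSet]

theorem card_residueSet {j : ℕ} (hj : j < 3) : (residueSet m j).card = 2 * m := by
  have hwin : ∀ i, windowCount (residueSet m j) i = 2 := fun i => by
    have h1 := val_add_one_mod_three i
    have h2 := val_add_one_mod_three (i + 1)
    simp only [windowCount, mem_residueSet]
    split_ifs <;> omega
  have hsum := sum_windowCount (residueSet m j)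
  simp only [hwin, Finset.sum_const, Finset.card_univ, Fintype.card_fin, smul_eq_mul] at hsum
  omega

theorem isDissociationSet_residueSet {j : ℕ} (hj : j < 3) :
    IsDissociationSet (cycleGraph (3 * m)) (residueSet m j) := by
  have hm := NeZero.pos m
  rw [isDissociationSet_iff]
  intro v hv a ha b hb hva hvb
  rw [cycleGraph_adj_iff_val (by omega)] at hva hvb
  rw [mem_residueSet] at hv ha hb
  omega

theorem residueSet_injOn : Set.InjOn (residueSet m) {j | j < 3} := by
  have hm := NeZero.pos m
  intro i (hi : i < 3) j _ h
  have hmem : (⟨i, by omega⟩ : Fin (3 * m)) ∉ residueSet m j := by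
    rw [← h, mem_residueSet, not_not, Nat.mod_eq_of_lt hi]
  rwa [mem_residueSet, not_not, Nat.mod_eq_of_lt hi] at hmem

theorem card_le_of_isDissociationSet_cycleGraph {S : Finset (Fin (3 * m))}
    (hS : IsDissociationSet (cycleGraph (3 * m)) S) : S.card ≤ 2 * m := by
  have hm := NeZero.pos m
  have := three_mul_card_le_of_isDissociationSet_cycleGraph (by omega) hS
  omega

theorem isDissociationSet_cycleGraph_and_card_eq_iff {S : Finset (Fin (3 * m))} :
    IsDissociationSet (cycleGraph (3 * m)) S ∧ S.card = 2 * m ↔ ∃ j < 3, S = residueSet m j := by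
  have hm := NeZero.pos m
  constructor
  · rintro ⟨hS, hcard⟩
    obtain ⟨j, hj, h⟩ :=
      exists_residue_of_windowCount_eq_two (windowCount_eq_two (by omega) hS (by omega))
    exact ⟨j, hj, Finset.ext fun i => (h i).trans mem_residueSet.symm⟩
  · rintro ⟨j, hj, rfl⟩
    exact ⟨isDissociationSet_residueSet hj, card_residueSet hj⟩

theorem not_isolatedFrom_residueSet {c : Fin (3 * m)} {j : ℕ} (hc : c ∈ residueSet m j) :
    ¬IsolatedFrom (cycleGraph (3 * m)) c (residueSet m j) := by
  intro h
  have hm : 2 ≤ 3 * m := by have := NeZero.pos m; omega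
  have hsucc : (c + 1).val % 3 = j := by
    by_contra hn
    exact h _ (mem_residueSet.2 hn) (cycleGraph_adj_add_one hm c)
  have hpred : (c - 1).val % 3 = j := by
    by_contra hn
    have hadj := cycleGraph_adj_add_one hm (c - 1)
    rw [sub_add_cancel] at hadj
    exact h _ (mem_residueSet.2 hn) hadj.symm
  have h1 := val_add_one_mod_three c
  have h2 := val_add_one_mod_three (c - 1)
  rw [sub_add_cancel] at h2
  rw [mem_residueSet] at hc
  omega

theorem hasTopCoeff_cardEnumerator_cycleGraph {q : Finset (Fin (3 * m)) → Prop}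
    {F : Finset (Finset (Fin (3 * m)))} {k : ℕ}
    (hF : ∀ S, S ∈ F ↔ (∃ j < 3, S = residueSet m j) ∧ q S) (hk : F.card = k) :
    HasTopCoeff (cardEnumerator fun S => IsDissociationSet (cycleGraph (3 * m)) S ∧ q S)
      (2 * m) k := by
  refine ⟨Polynomial.natDegree_le_iff_coeff_eq_zero.2 fun N hN => ?_, ?_⟩
  · rw [coeff_cardEnumerator, Set.ncard_eq_zero, Set.eq_empty_iff_forall_notMem]
    rintro S ⟨hS, rfl⟩
    exact hN.not_ge (card_le_of_isDissociationSet_cycleGraph hS.1)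
  · rw [coeff_cardEnumerator, ← hk, ← Set.ncard_coe_finset]
    congr 1
    ext S
    rw [Finset.mem_coe, hF, ← isDissociationSet_cycleGraph_and_card_eq_iff, and_right_comm]
    exact Iff.rfl

theorem hasTopCoeff_outPoly_cycleGraph (c : Fin (3 * m)) :
    HasTopCoeff (outPoly (cycleGraph (3 * m)) c) (2 * m) 1 := by
  refine hasTopCoeff_cardEnumerator_cycleGraph (F := {residueSet m (c.val % 3)}) (fun S => ?_) rfl
  rw [Finset.mem_singleton]
  constructor
  · rintro rfl
    exact ⟨⟨_, Nat.mod_lt _ three_pos, rfl⟩, fun h => mem_residueSet.1 h rfl⟩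
  · rintro ⟨⟨j, -, rfl⟩, h⟩
    rw [mem_residueSet, not_not] at h
    rw [h]

theorem hasTopCoeff_isolPoly_cycleGraph (c : Fin (3 * m)) :
    HasTopCoeff (isolPoly (cycleGraph (3 * m)) c) (2 * m) 0 := by
  refine hasTopCoeff_cardEnumerator_cycleGraph (F := ∅)
    (fun S => iff_of_false (Finset.notMem_empty S) ?_) rfl
  rintro ⟨⟨j, -, rfl⟩, hc, hisol⟩
  exact not_isolatedFrom_residueSet hc hisol

theorem hasTopCoeff_pairPoly_cycleGraph (c : Fin (3 * m)) :
    HasTopCoeff (pairPoly (cycleGraph (3 * m)) c) (2 * m) 2 := by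
  have hlt : ∀ a, a % 3 < 3 := fun a => Nat.mod_lt a three_pos
  refine hasTopCoeff_cardEnumerator_cycleGraph
    (F := {residueSet m ((c.val + 1) % 3), residueSet m ((c.val + 2) % 3)}) (fun S => ?_)
    (Finset.card_pair fun h => ?_)
  · rw [Finset.mem_insert, Finset.mem_singleton]
    constructor
    · have hmem : ∀ j < 3, c.val % 3 ≠ j → (∃ i < 3, residueSet m j = residueSet m i) ∧
          c ∈ residueSet m j ∧ ¬IsolatedFrom (cycleGraph (3 * m)) c (residueSet m j) :=
        fun j hj hc => ⟨⟨j, hj, rfl⟩, mem_residueSet.2 hc,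
          not_isolatedFrom_residueSet (mem_residueSet.2 hc)⟩
      rintro (rfl | rfl)
      · exact hmem _ (hlt _) (by omega)
      · exact hmem _ (hlt _) (by omega)
    · rintro ⟨⟨j, hj, rfl⟩, hc, -⟩
      rw [mem_residueSet] at hc
      have : j = (c.val + 1) % 3 ∨ j = (c.val + 2) % 3 := by omega
      exact this.imp (congrArg _) (congrArg _)
  · have := residueSet_injOn (hlt _) (hlt _) h
    omega

theorem pointedCycle_counted (c : Fin (3 * m)) :
    (pointedCycle (3 * m) c).Counted (3 * m) ⟨.free, 1, 0, 2⟩ :=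
  ⟨inferInstanceAs (Fintype (Fin (3 * m))), Fintype.card_fin _, 2 * m,
    hasTopCoeff_outPoly_cycleGraph c, hasTopCoeff_isolPoly_cycleGraph c,
    hasTopCoeff_pairPoly_cycleGraph c⟩

end Cycle

/-! ### The extremal potted graphs -/

section Families

open PointedGraph

variable {V : Type u} {G : SimpleGraph V} {k : ℕ} {B : List PointedGraph} {bs : List GraftTree}

theorem nonempty_iso_cycleAddEdge_iff {c : Fin k} {t : GraftTree} (hB : List.Forall₂ IsBranch B bs)
    (hp : t.children.Perm bs) : Nonempty (G ≃g cycleAddEdge k c (glue B)) ↔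
      Nonempty (G ≃g ((pointedCycle k c).attach [t]).graph) := by
  have hglue : (glue B).Iso t.toPointed := by
    rw [toPointed_eq_attach]
    exact (glue_iso hB).trans (point.attach_perm hp.symm)
  obtain ⟨e, -⟩ := (PointedIso.refl (cycleGraph k) c).joinByEdge hglue
  exact ⟨fun ⟨f⟩ => ⟨f.trans e⟩, fun ⟨f⟩ => ⟨f.trans e.symm⟩⟩

theorem nonempty_iso_cycleIdentify_iff {c : Fin k} {ts : List GraftTree}
    (hB : List.Forall₂ IsBranch B bs) (hp : ts.Perm bs) :
    Nonempty (G ≃g (cycleIdentify k c (glue B)).graph) ↔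
      Nonempty (G ≃g ((pointedCycle k c).attach ts).graph) := by
  obtain ⟨e, -⟩ := (glue_pair_iso (pointedCycle k c) _ (glue_iso hB)).trans
    ((pointedCycle k c).attach_perm hp.symm)
  exact ⟨fun ⟨f⟩ => ⟨f.trans e⟩, fun ⟨f⟩ => ⟨f.trans e.symm⟩⟩

theorem mem_edgeFamily_iff (hB : List.Forall₂ IsBranch B bs) :
    G ∈ edgeFamily V k {T | ∃ L, AllP4OrClaw L ∧ T = glue (B ++ L)} ↔
      ∃ (c : Fin k) (t : GraftTree), IsOrder3Extension bs t.children ∧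
        Nonempty (G ≃g ((pointedCycle k c).attach [t]).graph) := by
  constructor
  · rintro ⟨_, ⟨L, hL, rfl⟩, c, e⟩
    obtain ⟨M, hM, hLM⟩ := exists_forall₂_of_allP4OrClaw hL
    obtain ⟨t, ht⟩ := exists_children_eq (bs ++ M)
    have hp := List.Perm.of_eq ht
    exact ⟨c, t, ⟨M, hM, hp⟩,
      (nonempty_iso_cycleAddEdge_iff (List.rel_append hB hLM) hp).1 e⟩
  · rintro ⟨c, t, ⟨M, hM, hp⟩, e⟩
    obtain ⟨L, hL, hLM⟩ := exists_forall₂_of_allOrder3 hM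
    exact ⟨_, ⟨L, hL, rfl⟩, c, (nonempty_iso_cycleAddEdge_iff (List.rel_append hB hLM) hp).2 e⟩

theorem exists_iso_cycleIdentify_iff (hB : List.Forall₂ IsBranch B bs) :
    (∃ L, AllP4OrClaw L ∧ ∃ c : Fin k,
        Nonempty (G ≃g (cycleIdentify k c (glue (B ++ L))).graph)) ↔
      ∃ (c : Fin k) (ts : List GraftTree), IsOrder3Extension bs ts ∧
        Nonempty (G ≃g ((pointedCycle k c).attach ts).graph) := by
  constructor
  · rintro ⟨L, hL, c, e⟩
    obtain ⟨M, hM, hLM⟩ := exists_forall₂_of_allP4OrClaw hL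
    exact ⟨c, _, ⟨M, hM, .refl _⟩,
      (nonempty_iso_cycleIdentify_iff (List.rel_append hB hLM) (.refl _)).1 e⟩
  · rintro ⟨c, ts, ⟨M, hM, hp⟩, e⟩
    obtain ⟨L, hL, hLM⟩ := exists_forall₂_of_allOrder3 hM
    exact ⟨L, hL, c, (nonempty_iso_cycleIdentify_iff (List.rel_append hB hLM) hp).2 e⟩

theorem mem_potFamily1_iff : G ∈ potFamily1 V k ↔ ∃ (c : Fin k) (ts : List GraftTree),
    Extremal0 ts ∧ Nonempty (G ≃g ((pointedCycle k c).attach ts).graph) := by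
  have hB : ∀ m, List.Forall₂ IsBranch (leafPath 3 :: List.replicate m (leafPath 4))
      (path2 :: List.replicate m path3) := fun m =>
    .cons leafPath_three_isBranch (forall₂_isBranch_replicate m)
  constructor
  · rintro ⟨_, ⟨m, rfl⟩, c, e⟩
    obtain ⟨t, ht⟩ := exists_children_eq (path2 :: List.replicate m path3)
    have hp := List.Perm.of_eq ht
    exact ⟨c, [t], ⟨t, m, rfl, hp⟩, (nonempty_iso_cycleAddEdge_iff (hB m) hp).1 e⟩
  · rintro ⟨c, _, ⟨t, m, rfl, hp⟩, e⟩
    exact ⟨_, ⟨m, rfl⟩, c, (nonempty_iso_cycleAddEdge_iff (hB m) hp).2 e⟩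

theorem mem_potFamily2_iff : G ∈ potFamily2 V k ↔ ∃ (c : Fin k) (ts : List GraftTree),
    Extremal1 ts ∧ Nonempty (G ≃g ((pointedCycle k c).attach ts).graph) := by
  refine (mem_edgeFamily_iff
    (.cons leafPath_two_isBranch (.cons leafPath_three_isBranch .nil))).trans ?_
  constructor
  · rintro ⟨c, t, h, e⟩
    exact ⟨c, [t], ⟨t, rfl, h⟩, e⟩
  · rintro ⟨c, _, ⟨t, rfl, h⟩, e⟩
    exact ⟨c, t, h, e⟩

theorem mem_potFamily_union_iff : G ∈ potFamily3 V k ∪ potFamily4 V k ∪ potFamily5 V k ∪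
      potFamily6 V k ∪ potFamily7 V k ↔ ∃ (c : Fin k) (ts : List GraftTree),
    Extremal2 ts ∧ Nonempty (G ≃g ((pointedCycle k c).attach ts).graph) := by
  have h2 := leafPath_two_isBranch
  have h3 := leafPath_three_isBranch
  have hG3 : G ∈ potFamily3 V k ↔ _ := mem_edgeFamily_iff (.cons h3 (.cons h3 .nil))
  have hG4 : G ∈ potFamily4 V k ↔ _ := mem_edgeFamily_iff (.cons h2 (.cons h2 (.cons h3 .nil)))
  have hG5 : G ∈ potFamily5 V k ↔ _ :=
    mem_edgeFamily_iff (.cons h2 (.cons h2 (.cons h2 (.cons h2 .nil))))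
  have hG6 : G ∈ potFamily6 V k ↔ _ := exists_iso_cycleIdentify_iff (.cons h3 .nil)
  have hG7 : G ∈ potFamily7 V k ↔ _ := exists_iso_cycleIdentify_iff (.cons h2 (.cons h2 .nil))
  simp only [Set.mem_union, hG3, hG4, hG5, hG6, hG7]
  constructor
  · rintro ((((⟨c, t, h, e⟩ | ⟨c, t, h, e⟩) | ⟨c, t, h, e⟩) | ⟨c, ts, h, e⟩) | ⟨c, ts, h, e⟩)
    · exact ⟨c, [t], .inl ⟨t, rfl, .inl h⟩, e⟩
    · exact ⟨c, [t], .inl ⟨t, rfl, .inr (.inl h)⟩, e⟩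
    · exact ⟨c, [t], .inl ⟨t, rfl, .inr (.inr h)⟩, e⟩
    · exact ⟨c, ts, .inr (.inl h), e⟩
    · exact ⟨c, ts, .inr (.inr h), e⟩
  · rintro ⟨c, _, ⟨t, rfl, h | h | h⟩ | h | h, e⟩
    · exact .inl (.inl (.inl (.inl ⟨c, t, h, e⟩)))
    · exact .inl (.inl (.inl (.inr ⟨c, t, h, e⟩)))
    · exact .inl (.inl (.inr ⟨c, t, h, e⟩))
    · exact .inl (.inr ⟨c, _, h, e⟩)
    · exact .inr ⟨c, _, h, e⟩

end Families

section Potted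

variable {V : Type u} [Fintype V] {G : SimpleGraph V} {m : ℕ}

theorem potCount_pos (ts : List GraftTree) : 0 < potCount ts := by
  rw [potCount_eq]
  refine Nat.add_pos_left (List.prod_pos fun a ha => ?_) _
  obtain ⟨t, -, rfl⟩ := List.mem_map.1 ha
  exact t.count_pos.total_pos

theorem card_and_numMaxDissociationSets_of_iso [NeZero m] {c : Fin (3 * m)} {ts : List GraftTree}
    (e : G ≃g ((pointedCycle (3 * m) c).attach ts).graph) :
    Fintype.card V = 3 * m + (ts.map size).sum ∧ numMaxDissociationSets G = potCount ts := by
  obtain ⟨_, hcard, hcount⟩ := (pointedCycle_counted c).attach ts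
  refine ⟨(Fintype.card_congr e.toEquiv).trans hcard, ?_⟩
  rw [numMaxDissociationSets_congr e]
  exact hcount.numMaxDissociationSets_eq (potCount_pos ts)

theorem IsPotted.numMaxDissociationSets_le_and_eq_iff {n : ℕ} (h : IsPotted G n (3 * m))
    (hn : 3 * m + 4 ≤ n) {E : List GraftTree → Prop}
    (hE : ∀ ts, (ts.map size).sum = n - 3 * m →
      (potCount ts = potBound (n - 3 * m) ↔ E ts)) :
    numMaxDissociationSets G ≤ potBound (n - 3 * m) ∧
      (numMaxDissociationSets G = potBound (n - 3 * m) ↔ ∃ (c : Fin (3 * m)) (ts : List GraftTree),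
        E ts ∧ Nonempty (G ≃g ((pointedCycle (3 * m) c).attach ts).graph)) := by
  obtain ⟨hm, c, ts, ⟨e⟩⟩ := h.exists_iso_attach
  have : NeZero m := ⟨by omega⟩
  have hcount : ∀ (c : Fin (3 * m)) (ts : List GraftTree)
      (_ : G ≃g ((pointedCycle (3 * m) c).attach ts).graph),
      (ts.map size).sum = n - 3 * m ∧ numMaxDissociationSets G = potCount ts := fun c ts e => by
    obtain ⟨hcard, hG⟩ := card_and_numMaxDissociationSets_of_iso e
    have := h.1
    exact ⟨by omega, hG⟩
  obtain ⟨hsum, hG⟩ := hcount c ts e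
  refine ⟨?_, fun heq => ⟨c, ts, (hE ts hsum).1 (hG ▸ heq), ⟨e⟩⟩, ?_⟩
  · rw [hG, ← hsum]
    exact potCount_le_potBound (by omega)
  · rintro ⟨c', ts', hts', ⟨e'⟩⟩
    obtain ⟨hsum', hG'⟩ := hcount c' ts' e'
    rw [hG', (hE ts' hsum').2 hts']

end Potted

end

theorem theorem1p1 {V : Type*} [Fintype V] (G : SimpleGraph V) (n k : ℕ)
    (hn : k + 4 ≤ n) (hk : k ≡ 0 [MOD 3]) (hG : IsPotted G n k) :
    (n ≡ 0 [MOD 3] →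
      numMaxDissociationSets G ≤ 3 ^ ((n - k) / 3) + (n - k) / 3 + 1 ∧
      (numMaxDissociationSets G = 3 ^ ((n - k) / 3) + (n - k) / 3 + 1 ↔
        G ∈ potFamily1 V k)) ∧
    (n ≡ 1 [MOD 3] →
      numMaxDissociationSets G ≤ 3 ^ ((n - k - 1) / 3) + 1 ∧
      (numMaxDissociationSets G = 3 ^ ((n - k - 1) / 3) + 1 ↔
        G ∈ potFamily2 V k)) ∧
    (n ≡ 2 [MOD 3] →
      numMaxDissociationSets G ≤ 3 ^ ((n - k - 2) / 3) ∧
      (numMaxDissociationSets G = 3 ^ ((n - k - 2) / 3) ↔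
        G ∈ potFamily3 V k ∪ potFamily4 V k ∪ potFamily5 V k ∪ potFamily6 V k ∪
          potFamily7 V k)) := by
  obtain ⟨m, rfl⟩ := (Nat.modEq_zero_iff_dvd).1 hk
  rw [mem_potFamily1_iff, mem_potFamily2_iff, mem_potFamily_union_iff]
  simp only [Nat.ModEq]
  refine ⟨fun hmod => ?_, fun hmod => ?_, fun hmod => ?_⟩
  · obtain ⟨l, hl⟩ : ∃ l, n - 3 * m = 3 * l := ⟨(n - 3 * m) / 3, by omega⟩
    rw [hl, Nat.mul_div_cancel_left l three_pos, ← potBound_three_mul, ← hl]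
    exact hG.numMaxDissociationSets_le_and_eq_iff hn fun ts hts =>
      hts ▸ potCount_eq_potBound_iff_extremal0 (by omega) (by omega)
  · obtain ⟨l, hl⟩ : ∃ l, n - 3 * m = 3 * l + 1 := ⟨(n - 3 * m) / 3, by omega⟩
    rw [hl, Nat.add_sub_cancel, Nat.mul_div_cancel_left l three_pos,
      ← potBound_three_mul_add_one, ← hl]
    exact hG.numMaxDissociationSets_le_and_eq_iff hn fun ts hts =>
      hts ▸ potCount_eq_potBound_iff_extremal1 (by omega) (by omega)
  · obtain ⟨l, hl⟩ : ∃ l, n - 3 * m = 3 * l + 2 := ⟨(n - 3 * m) / 3, by omega⟩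
    rw [hl, Nat.add_sub_cancel, Nat.mul_div_cancel_left l three_pos,
      ← potBound_three_mul_add_two, ← hl]
    exact hG.numMaxDissociationSets_le_and_eq_iff hn fun ts hts =>
      hts ▸ potCount_eq_potBound_iff_extremal2 (by omega) (by omega)
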